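/- Let $k$ be an algebraically closed field of characteristic zero. For $n\ge 1$ let $\mathcal A_s(n)$ be the Hopf algebra over $k$ given by generators $u_{ij}$, $1\le i,j\le n$, and relations $$u_{ij}u_{il}=\delta_{jl}u_{ij},\qquad u_{ij}u_{lj}=\delta_{il}u_{ij},\qquad \sum_{l}u_{il}=1=\sum_{l}u_{li},$$ with $\Delta(u_{ij})=\sum_l u_{il}\otimes u_{lj}$, $\epsilon(u_{ij})=\delta_{ij}$, $\mathcal S(u_{ij})=u_{ji}$. A Hopf algebra $H$ is called a quantum permutation algebra if it is a quotient Hopf algebra of $\mathcal A_s(n)$ for some $n\ge 1$, and then its degree $d(H)$ is the smallest such $n$. A left coideal subalgebra of $H$ is a subalgebra $L\subseteq H$ with $\Delta(L)\subseteq H\otimes L$. Theorem. Let $k\to A\xrightarrow{\iota}H\xrightarrow{\pi}\overline H\to k$ be an exact sequence of Hopf algebras over $k$, with $H$ finite dimensional and cosemisimple; that is, $\iota,\pi$ are Hopf algebra maps, $\iota$ is injective, $\pi$ is surjective, and $\iota(A)=\{h\in H \mid (\mathrm{id}\otimes\pi)\Delta(h)=h\otimes 1\}$. Assume that (i) $A$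 is a quantum permutation algebra, and (ii) $\overline H$ is generated as an algebra by a finite subset $X$, and for every $x\in X$ there is a commutative left coideal subalgebra $L^x$ of $H$ with $x\in\pi(L^x)$. Then $H$ is a quantum permutation algebra. Moreover, for every choice of such $L^x$, $x\in X$, $$d(H)\le d(A)+\sum_{1\ne x\in X}\dim L^x .$$ -/

import Mathlib

open scoped TensorProduct

noncomputable section

/-! ### Magic matrices and the quantum permutation Hopf algebra `𝒜ₛ(n)` -/

/-- A square matrix with entries in a (not necessarily commutative) ring is magic if the entries
of each row, and of each column, are pairwise orthogonal idempotents with sum `1`. -/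
structure IsMagic {B : Type*} [Ring B] {n : ℕ} (v : Fin n → Fin n → B) : Prop where
  row_mul : ∀ i j l, v i j * v i l = if j = l then v i j else 0
  col_mul : ∀ i j l, v i j * v l j = if i = l then v i j else 0
  row_sum : ∀ i, ∑ l, v i l = 1
  col_sum : ∀ i, ∑ l, v l i = 1

/-- The defining relations of `𝒜ₛ(n)`, on the free algebra on the generators `uᵢⱼ`. -/
inductive QPermRel (k : Type*) [Field k] (n : ℕ) :
    FreeAlgebra k (Fin n × Fin n) → FreeAlgebra k (Fin n × Fin n) → Prop
  | row_mul (i j l : Fin n) : QPermRel k n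
      (FreeAlgebra.ι k (i, j) * FreeAlgebra.ι k (i, l))
      (if j = l then FreeAlgebra.ι k (i, j) else 0)
  | col_mul (i j l : Fin n) : QPermRel k n
      (FreeAlgebra.ι k (i, j) * FreeAlgebra.ι k (l, j))
      (if i = l then FreeAlgebra.ι k (i, j) else 0)
  | row_sum (i : Fin n) : QPermRel k n (∑ l, FreeAlgebra.ι k (i, l)) 1
  | col_sum (i : Fin n) : QPermRel k n (∑ l, FreeAlgebra.ι k (l, i)) 1

/-- The algebra `𝒜ₛ(n)`: the universal `k`-algebra generated by the entries of an `n × n` magic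
matrix. -/
def QPerm (k : Type*) [Field k] (n : ℕ) : Type _ := RingQuot (QPermRel k n)

namespace QPerm

variable (k : Type*) [Field k] (n : ℕ)

instance : Ring (QPerm k n) := inferInstanceAs (Ring (RingQuot (QPermRel k n)))

instance : Algebra k (QPerm k n) := inferInstanceAs (Algebra k (RingQuot (QPermRel k n)))

/-- The quotient map from the free algebra. -/
def mk : FreeAlgebra k (Fin n × Fin n) →ₐ[k] QPerm k n := RingQuot.mkAlgHom k (QPermRel k n)

variable {n}

/-- The generators `uᵢⱼ` of `𝒜ₛ(n)`. -/
def u (i j : Fin n) : QPerm k n := mk k n (FreeAlgebra.ι k (i, j))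

theorem mk_rel {x y : FreeAlgebra k (Fin n × Fin n)} (h : QPermRel k n x y) :
    mk k n x = mk k n y :=
  RingQuot.mkAlgHom_rel k h

theorem isMagic_u : IsMagic (u k (n := n)) where
  row_mul i j l := by
    have h := mk_rel k (QPermRel.row_mul (k := k) i j l)
    rw [map_mul, apply_ite (mk k n), map_zero] at h
    exact h
  col_mul i j l := by
    have h := mk_rel k (QPermRel.col_mul (k := k) i j l)
    rw [map_mul, apply_ite (mk k n), map_zero] at h
    exact h
  row_sum i := by
    have h := mk_rel k (QPermRel.row_sum (k := k) i)
    rw [map_sum, map_one] at h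
    exact h
  col_sum i := by
    have h := mk_rel k (QPermRel.col_sum (k := k) i)
    rw [map_sum, map_one] at h
    exact h

variable {k}

/-- The universal property of `𝒜ₛ(n)`. -/
def lift {B : Type*} [Ring B] [Algebra k B] (v : Fin n → Fin n → B) (hv : IsMagic v) :
    QPerm k n →ₐ[k] B :=
  RingQuot.liftAlgHom k ⟨FreeAlgebra.lift k fun p => v p.1 p.2, by
    intro x y h
    cases h with
    | row_mul i j l => simpa [apply_ite (FreeAlgebra.lift k _)] using hv.row_mul i j l
    | col_mul i j l => simpa [apply_ite (FreeAlgebra.lift k _)] using hv.col_mul i j l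
    | row_sum i => simpa using hv.row_sum i
    | col_sum i => simpa using hv.col_sum i⟩

@[simp]
theorem lift_u {B : Type*} [Ring B] [Algebra k B] (v : Fin n → Fin n → B) (hv : IsMagic v)
    (i j : Fin n) : lift (k := k) v hv (u k i j) = v i j := by
  have h := RingQuot.liftAlgHom_mkAlgHom_apply (S := k) (s := QPermRel k n)
    (FreeAlgebra.lift k fun p : Fin n × Fin n => v p.1 p.2)
  refine (h _ (FreeAlgebra.ι k (i, j))).trans ?_
  simp

theorem hom_ext {B : Type*} [Semiring B] [Algebra k B] {f g : QPerm k n →ₐ[k] B}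
    (h : ∀ i j, f (u k i j) = g (u k i j)) : f = g := by
  refine RingQuot.ringQuot_ext' k f g (FreeAlgebra.hom_ext ?_)
  funext p
  exact h p.1 p.2

theorem adjoin_u : Algebra.adjoin k (Set.range fun p : Fin n × Fin n => u k p.1 p.2) = ⊤ := by
  have h : (mk k n).range = ⊤ :=
    (AlgHom.range_eq_top _).2 (RingQuot.mkAlgHom_surjective k (QPermRel k n))
  rw [← h, ← Algebra.map_top, ← FreeAlgebra.adjoin_range_ι, AlgHom.map_adjoin, ← Set.range_comp]
  rfl

/-! The Hopf algebra structure `Δ(uᵢⱼ) = ∑ₗ uᵢₗ ⊗ uₗⱼ`, `ε(uᵢⱼ) = δᵢⱼ`, `S(uᵢⱼ) = uⱼᵢ`. -/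

theorem isMagic_comul :
    IsMagic fun i j : Fin n => ∑ l, u k i l ⊗ₜ[k] u k l j where
  row_mul i j l := by
    simp only [Finset.sum_mul_sum, Algebra.TensorProduct.tmul_mul_tmul, (isMagic_u k).row_mul]
    simp only [TensorProduct.ite_tmul, Finset.sum_ite_eq,
      Finset.mem_univ, if_true, (isMagic_u k).row_mul]
    split_ifs <;> simp
  col_mul i j l := by
    simp only [Finset.sum_mul_sum, Algebra.TensorProduct.tmul_mul_tmul, (isMagic_u k).col_mul]
    simp only [TensorProduct.tmul_ite, Finset.sum_ite_eq,
      Finset.mem_univ, if_true, (isMagic_u k).col_mul]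
    split_ifs <;> simp
  row_sum i := by
    rw [Finset.sum_comm]
    simp only [← TensorProduct.tmul_sum, (isMagic_u k).row_sum]
    rw [← TensorProduct.sum_tmul, (isMagic_u k).row_sum]
    rfl
  col_sum i := by
    rw [Finset.sum_comm]
    simp only [← TensorProduct.sum_tmul, (isMagic_u k).col_sum]
    rw [← TensorProduct.tmul_sum, (isMagic_u k).col_sum]
    rfl

theorem isMagic_counit : IsMagic fun i j : Fin n => if i = j then (1 : k) else 0 where
  row_mul i j l := by grind
  col_mul i j l := by grind
  row_sum i := by simp
  col_sum i := by simp

theorem isMagic_antipode : IsMagic fun i j : Fin n => MulOpposite.op (u k j i) where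
  row_mul i j l := by
    rw [← MulOpposite.op_mul, (isMagic_u k).col_mul]
    split_ifs with h1 h2 h2 <;> simp_all
  col_mul i j l := by
    rw [← MulOpposite.op_mul, (isMagic_u k).row_mul]
    split_ifs with h1 h2 h2 <;> simp_all
  row_sum i := by
    rw [← Finset.op_sum, (isMagic_u k).col_sum, MulOpposite.op_one]
  col_sum i := by
    rw [← Finset.op_sum, (isMagic_u k).row_sum, MulOpposite.op_one]

variable (k n)

/-- The comultiplication of `𝒜ₛ(n)`. -/
def comulHom : QPerm k n →ₐ[k] QPerm k n ⊗[k] QPerm k n :=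
  lift (fun i j => ∑ l, u k i l ⊗ₜ[k] u k l j) isMagic_comul

/-- The counit of `𝒜ₛ(n)`. -/
def counitHom : QPerm k n →ₐ[k] k :=
  lift (fun i j => if i = j then (1 : k) else 0) isMagic_counit

/-- The antipode of `𝒜ₛ(n)`, as a homomorphism to the opposite algebra. -/
def antipodeHom : QPerm k n →ₐ[k] (QPerm k n)ᵐᵒᵖ :=
  lift (fun i j => MulOpposite.op (u k j i)) isMagic_antipode

instance : Bialgebra k (QPerm k n) :=
  Bialgebra.ofAlgHom (comulHom k n) (counitHom k n)
    (hom_ext fun i j => by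
      simp [comulHom, TensorProduct.sum_tmul, TensorProduct.tmul_sum]
      exact Finset.sum_comm)
    (hom_ext fun i j => by
      simp [comulHom, counitHom, TensorProduct.ite_tmul])
    (hom_ext fun i j => by
      simp [comulHom, counitHom, TensorProduct.tmul_ite])

variable {k n}

theorem comul_u (i j : Fin n) :
    Coalgebra.comul (R := k) (u k i j) = ∑ l, u k i l ⊗ₜ[k] u k l j :=
  lift_u _ isMagic_comul i j

theorem counit_u (i j : Fin n) :
    Coalgebra.counit (R := k) (u k i j) = if i = j then (1 : k) else 0 :=
  lift_u _ isMagic_counit i j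

variable (k n)

/-- The antipode of `𝒜ₛ(n)`, as a linear map. -/
def antipodeLin : QPerm k n →ₗ[k] QPerm k n :=
  (MulOpposite.opLinearEquiv k).symm.toLinearMap ∘ₗ (antipodeHom k n).toLinearMap

variable {k n}

theorem antipodeLin_u (i j : Fin n) : antipodeLin k n (u k i j) = u k j i := by
  simp [antipodeLin, antipodeHom]

theorem antipodeLin_one : antipodeLin k n 1 = 1 := by
  simp [antipodeLin]

theorem antipodeLin_mul (a b : QPerm k n) :
    antipodeLin k n (a * b) = antipodeLin k n b * antipodeLin k n a := by
  simp [antipodeLin]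

theorem antipodeLin_algebraMap (r : k) :
    antipodeLin k n (algebraMap k _ r) = algebraMap k _ r := by
  rw [Algebra.algebraMap_eq_smul_one, map_smul, antipodeLin_one]

theorem mul_antipode_rTensor (a : QPerm k n) :
    LinearMap.mul' k _ ((antipodeLin k n).rTensor _ (Coalgebra.comul (R := k) a)) =
      algebraMap k _ (Coalgebra.counit (R := k) a) := by
  have ha : a ∈ Algebra.adjoin k (Set.range fun p : Fin n × Fin n => u k p.1 p.2) := by
    rw [adjoin_u]; trivial
  induction ha using Algebra.adjoin_induction with
  | mem x hx =>
    obtain ⟨⟨i, j⟩, rfl⟩ := hx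
    simp only [comul_u, counit_u, map_sum, LinearMap.rTensor_tmul, LinearMap.mul'_apply,
      antipodeLin_u, (isMagic_u k).row_mul]
    by_cases h : i = j
    · subst h; simp [(isMagic_u k).col_sum]
    · simp [h]
  | algebraMap r =>
    rw [Bialgebra.comul_algebraMap, Algebra.TensorProduct.algebraMap_apply]
    simp [antipodeLin_algebraMap]
  | add x y _ _ hx hy => simp [hx, hy]
  | mul x y _ _ hx hy =>
    have key : ∀ s t : QPerm k n ⊗[k] QPerm k n,
        LinearMap.mul' k _ ((antipodeLin k n).rTensor _ s) ∈
            (⊥ : Subalgebra k (QPerm k n)) →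
        LinearMap.mul' k _ ((antipodeLin k n).rTensor _ (s * t)) =
          LinearMap.mul' k _ ((antipodeLin k n).rTensor _ s) *
            LinearMap.mul' k _ ((antipodeLin k n).rTensor _ t) := by
      intro s t hs
      induction t with
      | zero => simp
      | add t₁ t₂ h₁ h₂ => simp [mul_add, h₁, h₂]
      | tmul c d =>
        have h : LinearMap.mul' k _ ((antipodeLin k n).rTensor _ (s * c ⊗ₜ[k] d)) =
            antipodeLin k n c * LinearMap.mul' k _ ((antipodeLin k n).rTensor _ s) * d := by
          clear hs
          induction s with
          | zero => simp
          | add s₁ s₂ h₁ h₂ => simp [add_mul, mul_add, h₁, h₂]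
          | tmul e f => simp [antipodeLin_mul, mul_assoc]
        obtain ⟨r, hr⟩ := Algebra.mem_bot.1 hs
        rw [h, ← hr, ← Algebra.commutes]
        simp [mul_assoc]
    rw [Bialgebra.comul_mul, key _ _ (by rw [hx]; exact Subalgebra.algebraMap_mem _ _), hx, hy,
      Bialgebra.counit_mul, map_mul]

theorem mul_antipode_lTensor (a : QPerm k n) :
    LinearMap.mul' k _ ((antipodeLin k n).lTensor _ (Coalgebra.comul (R := k) a)) =
      algebraMap k _ (Coalgebra.counit (R := k) a) := by
  have ha : a ∈ Algebra.adjoin k (Set.range fun p : Fin n × Fin n => u k p.1 p.2) := by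
    rw [adjoin_u]; trivial
  induction ha using Algebra.adjoin_induction with
  | mem x hx =>
    obtain ⟨⟨i, j⟩, rfl⟩ := hx
    simp only [comul_u, counit_u, map_sum, LinearMap.lTensor_tmul, LinearMap.mul'_apply,
      antipodeLin_u, (isMagic_u k).col_mul]
    by_cases h : i = j
    · subst h; simp [(isMagic_u k).row_sum]
    · simp [h]
  | algebraMap r =>
    rw [Bialgebra.comul_algebraMap, Algebra.TensorProduct.algebraMap_apply]
    simp [antipodeLin_one]
  | add x y _ _ hx hy => simp [hx, hy]
  | mul x y _ _ hx hy =>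
    have key : ∀ s t : QPerm k n ⊗[k] QPerm k n,
        LinearMap.mul' k _ ((antipodeLin k n).lTensor _ t) ∈
            (⊥ : Subalgebra k (QPerm k n)) →
        LinearMap.mul' k _ ((antipodeLin k n).lTensor _ (s * t)) =
          LinearMap.mul' k _ ((antipodeLin k n).lTensor _ s) *
            LinearMap.mul' k _ ((antipodeLin k n).lTensor _ t) := by
      intro s t ht
      induction s with
      | zero => simp
      | add s₁ s₂ h₁ h₂ => simp [add_mul, h₁, h₂]
      | tmul c d =>
        have h : LinearMap.mul' k _ ((antipodeLin k n).lTensor _ (c ⊗ₜ[k] d * t)) =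
            c * LinearMap.mul' k _ ((antipodeLin k n).lTensor _ t) * antipodeLin k n d := by
          clear ht
          induction t with
          | zero => simp
          | add t₁ t₂ h₁ h₂ => simp [add_mul, mul_add, h₁, h₂]
          | tmul e f => simp [antipodeLin_mul, mul_assoc]
        obtain ⟨r, hr⟩ := Algebra.mem_bot.1 ht
        rw [h, ← hr, mul_assoc, Algebra.commutes]
        simp [mul_assoc]
    rw [Bialgebra.comul_mul, key _ _ (by rw [hy]; exact Subalgebra.algebraMap_mem _ _), hx, hy,
      Bialgebra.counit_mul, map_mul]

instance : HopfAlgebra k (QPerm k n) where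
  antipode := antipodeLin k n
  mul_antipode_rTensor_comul := LinearMap.ext mul_antipode_rTensor
  mul_antipode_lTensor_comul := LinearMap.ext mul_antipode_lTensor

end QPerm

/-! ### Quantum permutation algebras and their degree -/

/-- `H` is a quotient Hopf algebra of `𝒜ₛ(n)`. (A homomorphism of bialgebras between Hopf algebras
automatically commutes with the antipodes.) -/
def IsQPermQuotient (k : Type*) [Field k] (H : Type*) [Ring H] [HopfAlgebra k H] (n : ℕ) : Prop :=
  ∃ f : QPerm k n →ₐc[k] H, Function.Surjective f

/-- `H` is a quantum permutation algebra: a quotient Hopf algebra of `𝒜ₛ(n)` for some `n ≥ 1`. -/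
def IsQuantumPermutationAlgebra (k : Type*) [Field k] (H : Type*) [Ring H] [HopfAlgebra k H] :
    Prop :=
  ∃ n : ℕ, 1 ≤ n ∧ IsQPermQuotient k H n

/-- The degree of a quantum permutation algebra `H`: the smallest `n ≥ 1` such that `H` is a
quotient Hopf algebra of `𝒜ₛ(n)`. It is only meaningful if `H` is a quantum permutation algebra. -/
def qpDegree (k : Type*) [Field k] (H : Type*) [Ring H] [HopfAlgebra k H] : ℕ :=
  sInf {n : ℕ | 1 ≤ n ∧ IsQPermQuotient k H n}

/-! ### Cosemisimplicity, coideal subalgebras, exact sequences -/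

section Coalgebra

variable {k : Type*} [Field k] {C : Type*} [AddCommGroup C] [Module k C] [Coalgebra k C]

/-- A subspace `D` of a coalgebra is a subcoalgebra if `Δ(D) ⊆ D ⊗ D`. -/
def IsSubcoalgebra (D : Submodule k C) : Prop :=
  ∀ x ∈ D, Coalgebra.comul (R := k) x ∈ LinearMap.range (TensorProduct.map D.subtype D.subtype)

/-- A subcoalgebra is simple if it is nonzero and has no proper nonzero subcoalgebra. -/
structure IsSimpleSubcoalgebra (D : Submodule k C) : Prop where
  isSubcoalgebra : IsSubcoalgebra D
  ne_bot : D ≠ ⊥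
  eq_bot_or_eq : ∀ E : Submodule k C, E ≤ D → IsSubcoalgebra E → E = ⊥ ∨ E = D

variable (k C) in
/-- The coradical of a coalgebra: the sum of its simple subcoalgebras. -/
def coradical : Submodule k C := sSup {D | IsSimpleSubcoalgebra D}

variable (k C) in
/-- A coalgebra is cosemisimple if it is equal to its coradical. -/
def IsCosemisimple : Prop := coradical k C = ⊤

end Coalgebra

section Hopf

variable {k : Type*} [Field k] {A H Q : Type*} [Ring A] [HopfAlgebra k A]
  [Ring H] [HopfAlgebra k H] [Ring Q] [HopfAlgebra k Q]

/-- A commutative left coideal subalgebra: a commutative subalgebra `L` of `H` such that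
`Δ(L) ⊆ H ⊗ L`. -/
structure IsCommLeftCoidealSubalgebra (L : Subalgebra k H) : Prop where
  mul_comm : ∀ x ∈ L, ∀ y ∈ L, x * y = y * x
  comul_mem : ∀ x ∈ L, Coalgebra.comul (R := k) x ∈
    LinearMap.range (TensorProduct.map (LinearMap.id : H →ₗ[k] H) (Subalgebra.toSubmodule L).subtype)

/-- The coinvariants `{h ∈ H | (id ⊗ π) Δ(h) = h ⊗ 1}` of a Hopf algebra map `π`. -/
def hopfCoinvariants (π : H →ₐc[k] Q) : Set H :=
  {h | TensorProduct.map (LinearMap.id : H →ₗ[k] H) (π : H →ₗ[k] Q)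
      (Coalgebra.comul (R := k) h) = h ⊗ₜ[k] (1 : Q)}

/-- The sequence `k → A → H → Q → k` of Hopf algebra maps is exact. -/
structure IsHopfExact (ι : A →ₐc[k] H) (π : H →ₐc[k] Q) : Prop where
  injective : Function.Injective ι
  surjective : Function.Surjective π
  range_eq : Set.range ι = hopfCoinvariants π

end Hopf

end

open scoped TensorProduct

noncomputable section

/-! ### Slice maps and subcoalgebras -/

section Slice

variable {k : Type*} [Field k] {C D : Type*} [AddCommGroup C] [Module k C] [AddCommGroup D]
  [Module k D]

/-! A quantum permutation algebra is a Hopf algebra generated by the entries of a magic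
corepresentation, and block sums of magic corepresentations add their sizes. So it is enough to
attach to each $L^x$ with $x\ne 1$ one of size $\dim L^x$ whose entries generate an algebra
containing $L^x$, and to show that the block sum of these with the one coming from $A$ has entries
generating $H$.

Cosemisimplicity gives $\psi$ on $H$ with $\psi(1)=1$ and
$(\mathrm{id}\otimes\psi)\Delta=\psi(\cdot)1$. On a left coideal subalgebra the radical of the form
of an invariant functional is a left coideal, so it vanishes or generates $H$ as a left ideal
(`leftRadical_eq_bot_or`). For commutative $L$ and a functional that is nonzero at $1$, a Nakayama
argument excludes the second case (`leftRadical_eq_bot`). This is used twice. For $\psi|_L$ it makes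
the Gram matrix invertible, so $S^2$ is trivial on the coefficients of $L$ and the regular trace is
invariant (`isInvariantFunctional_trace`). For the trace, nonzero at $1$ in characteristic zero, it
shows that $L$ is reduced. Hence $L$ is a product of copies of $k$, and its coefficient matrix in
the basis of minimal idempotents is magic (`exists_isMagicCorepresentation_of_coideal`).

The block sum gives $f:U=\mathcal A_s(N)\to H$ whose image contains the coinvariants and maps onto
$\overline H$. Since $U$ is involutory, so is its quotient $\overline H$. The regular trace
$\varphi$ of $\overline H$ is therefore an integral, and some $t\in U$ satisfies $\varphi(x\,\pi
f(t))=\epsilon(x)$ for all $x$. Put $E(m)=m_1\varphi(\pi(m_2))$, which is coinvariant. Then every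
$h\in H$ equals $\sum E(h f(t_2))f(S(t_1))$, so $f$ is surjective
(`surjective_of_hopfCoinvariants_subset`). -/

/-- The slice map `f ⊗ id`. -/
def sliceLeft (f : C →ₗ[k] k) : C ⊗[k] D →ₗ[k] D :=
  (TensorProduct.lid k D).toLinearMap ∘ₗ f.rTensor D

/-- The slice map `id ⊗ f`. -/
def sliceRight (f : D →ₗ[k] k) : C ⊗[k] D →ₗ[k] C :=
  (TensorProduct.rid k C).toLinearMap ∘ₗ f.lTensor C

@[simp]
theorem sliceLeft_tmul (f : C →ₗ[k] k) (x : C) (y : D) :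
    sliceLeft f (x ⊗ₜ[k] y) = f x • y := by
  simp [sliceLeft]

@[simp]
theorem sliceRight_tmul (f : D →ₗ[k] k) (x : C) (y : D) :
    sliceRight f (x ⊗ₜ[k] y) = f y • x := by
  simp [sliceRight]

theorem eq_of_sliceLeft_eq {s t : C ⊗[k] D}
    (h : ∀ f : C →ₗ[k] k, sliceLeft f s = sliceLeft f t) : s = t := by
  let b := Module.Basis.ofVectorSpace k C
  let c := Module.Basis.ofVectorSpace k D
  have key : ∀ (u : C ⊗[k] D) i j,
      (b.tensorProduct c).repr u (i, j) = c.repr (sliceLeft (b.coord i) u) j := by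
    intro u i j
    induction u with
    | zero => simp
    | add x y hx hy => simp [hx, hy]
    | tmul x y => simp [mul_comm]
  refine (b.tensorProduct c).ext_elem fun ⟨i, j⟩ => ?_
  rw [key, key, h]

theorem eq_of_sliceRight_eq {s t : C ⊗[k] D}
    (h : ∀ f : D →ₗ[k] k, sliceRight f s = sliceRight f t) : s = t := by
  let b := Module.Basis.ofVectorSpace k C
  let c := Module.Basis.ofVectorSpace k D
  have key : ∀ (u : C ⊗[k] D) i j,
      (b.tensorProduct c).repr u (i, j) = b.repr (sliceRight (c.coord j) u) i := by
    intro u i j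
    induction u with
    | zero => simp
    | add x y hx hy => simp [hx, hy]
    | tmul x y => simp [mul_comm]
  refine (b.tensorProduct c).ext_elem fun ⟨i, j⟩ => ?_
  rw [key, key, h]

theorem sliceLeft_lTensor {E : Type*} [AddCommGroup E] [Module k E] (f : C →ₗ[k] k)
    (q : D →ₗ[k] E) (t : C ⊗[k] D) :
    sliceLeft f (q.lTensor C t) = q (sliceLeft f t) := by
  induction t with
  | zero => simp
  | add x y hx hy => simp [hx, hy]
  | tmul x y => simp

theorem sliceRight_rTensor {E : Type*} [AddCommGroup E] [Module k E] (f : D →ₗ[k] k)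
    (q : C →ₗ[k] E) (t : C ⊗[k] D) :
    sliceRight f (q.rTensor D t) = q (sliceRight f t) := by
  induction t with
  | zero => simp
  | add x y hx hy => simp [hx, hy]
  | tmul x y => simp

/-- A tensor lies in `V ⊗ V` as soon as all its slices lie in `V`. -/
theorem mem_range_map_subtype (V : Submodule k C) {t : C ⊗[k] C}
    (hl : ∀ f : C →ₗ[k] k, sliceLeft f t ∈ V) (hr : ∀ f : C →ₗ[k] k, sliceRight f t ∈ V) :
    t ∈ LinearMap.range (TensorProduct.map V.subtype V.subtype) := by
  -- A projection onto `V` applied to either leg fixes `t`, because it fixes all slices.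
  obtain ⟨p, hp⟩ := V.subtype.exists_leftInverse_of_injective V.ker_subtype
  have hq : ∀ x ∈ V, (V.subtype ∘ₗ p) x = x := fun x hx => by
    have := LinearMap.congr_fun hp ⟨x, hx⟩
    simpa using congrArg Subtype.val this
  have h1 : (V.subtype ∘ₗ p).lTensor C t = t :=
    eq_of_sliceLeft_eq fun f => by rw [sliceLeft_lTensor, hq _ (hl f)]
  have h2 : (V.subtype ∘ₗ p).rTensor C t = t :=
    eq_of_sliceRight_eq fun f => by rw [sliceRight_rTensor, hq _ (hr f)]
  refine ⟨TensorProduct.map p p t, ?_⟩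
  rw [← LinearMap.comp_apply, ← TensorProduct.map_comp]
  conv_rhs => rw [← h2, ← h1]
  rw [← LinearMap.comp_apply (LinearMap.rTensor _ _), LinearMap.rTensor_comp_lTensor]

end Slice

/-! ### Lattice of subcoalgebras and complements -/

section Subcoalgebra

variable {k : Type*} [Field k] {C : Type*} [AddCommGroup C] [Module k C] [Coalgebra k C]

/-- Slices turn membership in `V ⊗ V` into membership in `V`, which visibly passes to intersections
and sums. -/
theorem isSubcoalgebra_iff {V : Submodule k C} :
    IsSubcoalgebra V ↔ ∀ x ∈ V, ∀ f : C →ₗ[k] k,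
      sliceLeft f (Coalgebra.comul (R := k) x) ∈ V ∧
        sliceRight f (Coalgebra.comul (R := k) x) ∈ V := by
  constructor
  · intro h x hx f
    obtain ⟨t, ht⟩ := h x hx
    rw [← ht]
    clear ht
    induction t with
    | zero => simp
    | add s t hs ht =>
      simp only [map_add]
      exact ⟨V.add_mem hs.1 ht.1, V.add_mem hs.2 ht.2⟩
    | tmul a b =>
      simp only [TensorProduct.map_tmul, Submodule.subtype_apply, sliceLeft_tmul, sliceRight_tmul]
      exact ⟨V.smul_mem _ b.2, V.smul_mem _ a.2⟩
  · intro h x hx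
    exact mem_range_map_subtype V (fun f => (h x hx f).1) fun f => (h x hx f).2

theorem IsSubcoalgebra.inf {V W : Submodule k C} (hV : IsSubcoalgebra V)
    (hW : IsSubcoalgebra W) : IsSubcoalgebra (V ⊓ W) := by
  rw [isSubcoalgebra_iff] at *
  exact fun x hx f => ⟨⟨(hV x hx.1 f).1, (hW x hx.2 f).1⟩, ⟨(hV x hx.1 f).2, (hW x hx.2 f).2⟩⟩

theorem IsSubcoalgebra.sup {V W : Submodule k C} (hV : IsSubcoalgebra V)
    (hW : IsSubcoalgebra W) : IsSubcoalgebra (V ⊔ W) := by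
  rw [isSubcoalgebra_iff] at *
  intro x hx f
  obtain ⟨y, hy, z, hz, rfl⟩ := Submodule.mem_sup.1 hx
  simp only [map_add]
  exact ⟨Submodule.add_mem_sup (hV y hy f).1 (hW z hz f).1,
    Submodule.add_mem_sup (hV y hy f).2 (hW z hz f).2⟩

theorem isSubcoalgebra_bot : IsSubcoalgebra (⊥ : Submodule k C) := by
  rw [isSubcoalgebra_iff]
  rintro x hx f
  simp [(Submodule.mem_bot k).1 hx]

/-- In a finite-dimensional cosemisimple coalgebra, subcoalgebras have complements. -/
theorem IsCosemisimple.exists_isCompl [FiniteDimensional k C] (hC : IsCosemisimple k C)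
    {V : Submodule k C} (hV : IsSubcoalgebra V) :
    ∃ W : Submodule k C, IsSubcoalgebra W ∧ IsCompl V W := by
  -- Take `W` maximal among subcoalgebras disjoint from `V`. A simple subcoalgebra outside `V ⊔ W`
  -- meets it trivially and could be added to `W`.
  obtain ⟨W, ⟨hW, hVW⟩, hmax⟩ := (wellFounded_gt (α := Submodule k C)).has_min
    {W | IsSubcoalgebra W ∧ Disjoint V W} ⟨⊥, isSubcoalgebra_bot, disjoint_bot_right⟩
  refine ⟨W, hW, hVW, ?_⟩
  rw [codisjoint_iff, eq_top_iff, ← show coradical k C = ⊤ from hC]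
  refine sSup_le fun E hE => ?_
  by_contra hle
  have hdis : (V ⊔ W) ⊓ E = ⊥ :=
    (hE.eq_bot_or_eq _ inf_le_right ((hV.sup hW).inf hE.isSubcoalgebra)).resolve_right
      fun h => hle (h ▸ inf_le_left)
  refine hmax (W ⊔ E) ⟨hW.sup hE.isSubcoalgebra, ?_⟩ ?_
  · exact hVW.disjoint_sup_right_of_disjoint_sup_left (disjoint_iff.2 hdis)
  · refine lt_of_le_of_ne le_sup_left fun h => hE.ne_bot ?_
    rw [eq_bot_iff, ← hdis]
    exact le_inf ((le_sup_right.trans h.symm.le).trans le_sup_right) le_rfl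

end Subcoalgebra

/-- A finite-dimensional cosemisimple Hopf algebra has a normalized left integral in its dual. -/
theorem IsCosemisimple.exists_integral {k : Type*} [Field k] {H : Type*} [Ring H]
    [HopfAlgebra k H] [FiniteDimensional k H] (hH : IsCosemisimple k H) :
    ∃ φ : H →ₗ[k] k, φ 1 = 1 ∧
      ∀ h, sliceRight φ (Coalgebra.comul (R := k) h) = algebraMap k H (φ h) := by
  have h1 : IsSubcoalgebra (Submodule.span k {(1 : H)}) := by
    rw [isSubcoalgebra_iff]
    intro x hx f
    obtain ⟨c, rfl⟩ := Submodule.mem_span_singleton.1 hx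
    simp only [map_smul, Bialgebra.comul_one, Algebra.TensorProduct.one_def, sliceLeft_tmul,
      sliceRight_tmul]
    have h := Submodule.smul_mem _ c (Submodule.smul_mem _ (f 1)
      (Submodule.mem_span_singleton_self (R := k) (1 : H)))
    exact ⟨h, h⟩
  -- The integral is the normalized functional killing a subcoalgebra complement `W` of $k1$; as
  -- $\Delta(W)\subseteq W\otimes W$, slicing annihilates $\Delta(W)$.
  obtain ⟨W, hW, hdis, hcod⟩ := hH.exists_isCompl h1
  have h0 : (1 : H) ≠ 0 := fun h => by
    have := congrArg (Coalgebra.counit (R := k)) h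
    simp at this
  have hnot : (1 : H) ∉ W := fun h =>
    h0 (Submodule.disjoint_def.1 hdis 1 (Submodule.mem_span_singleton_self _) h)
  obtain ⟨f, hf1, hfW⟩ := Submodule.exists_le_ker_of_notMem hnot
  refine ⟨(f 1)⁻¹ • f, by simp [hf1], fun h => ?_⟩
  have hmem : h ∈ Submodule.span k {(1 : H)} ⊔ W := by
    rw [codisjoint_iff.1 hcod]; trivial
  obtain ⟨y, hy, z, hz, rfl⟩ := Submodule.mem_sup.1 hmem
  obtain ⟨c, rfl⟩ := Submodule.mem_span_singleton.1 hy
  have hz0 : sliceRight ((f 1)⁻¹ • f) (Coalgebra.comul (R := k) z) = 0 := by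
    obtain ⟨t, ht⟩ := hW z hz
    rw [← ht]
    clear ht
    induction t with
    | zero => simp
    | add s t hs ht => simp [hs, ht]
    | tmul a b =>
      have : f b = 0 := hfW b.2
      simp [this]
  have hfz : f z = 0 := hfW hz
  rw [map_add, map_add, hz0, map_smul, Bialgebra.comul_one, Algebra.TensorProduct.one_def]
  simp [hf1, hfz, Algebra.algebraMap_eq_smul_one, mul_left_comm _ c]

/-! ### Coefficient matrices of coideal subalgebras -/

section Coefficient

variable {k : Type*} [Field k] {H : Type*} [Ring H] [HopfAlgebra k H]
  {R : Type*} [Ring R] [Algebra k R] {ι : Type*} [Fintype ι]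

theorem LinearIndependent.exists_dual [DecidableEq ι] {V : Type*} [AddCommGroup V] [Module k V]
    {c : ι → V} (hc : LinearIndependent k c) (i : ι) :
    ∃ f : V →ₗ[k] k, ∀ a, f (c a) = if a = i then 1 else 0 := by
  obtain ⟨g, hg⟩ := (Fintype.linearCombination k c).exists_leftInverse_of_injective
    (LinearMap.ker_eq_bot.2 hc.fintypeLinearCombination_injective)
  refine ⟨LinearMap.proj i ∘ₗ g, fun a => ?_⟩
  have h := LinearMap.congr_fun hg (Pi.single a 1)
  simp only [LinearMap.comp_apply, Fintype.linearCombination_apply_single, one_smul,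
    LinearMap.id_apply] at h
  simp [h, Pi.single_apply, eq_comm]

theorem eq_of_sum_tmul_eq {V W : Type*} [AddCommGroup V] [Module k V] [AddCommGroup W]
    [Module k W] {c : ι → W} (hc : LinearIndependent k c) {x y : ι → V}
    (h : ∑ a, x a ⊗ₜ[k] c a = ∑ a, y a ⊗ₜ[k] c a) : x = y := by
  classical
  funext i
  obtain ⟨f, hf⟩ := hc.exists_dual i
  simpa [hf] using congrArg (sliceRight f) h

/-- The matrix `v` with entries in `H` is the coefficient matrix of the left coideal subalgebra
`j(R)` of `H` with respect to the basis `b` of `R`. -/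
structure IsCoefficientMatrix (j : R →ₐ[k] H) (b : Module.Basis ι k R) (v : Matrix ι ι H) :
    Prop where
  injective : Function.Injective j
  comul_eq : ∀ i, Coalgebra.comul (R := k) (j (b i)) = ∑ a, v i a ⊗ₜ[k] j (b a)

/-- Using an embedded algebra `R` instead of a subalgebra lets `R` carry a `CommRing` structure, and
also allows `R = H`. -/
theorem exists_isCoefficientMatrix (j : R →ₐ[k] H) (hj : Function.Injective j)
    (hΔ : ∀ x, Coalgebra.comul (R := k) (j x) ∈
      LinearMap.range (TensorProduct.map (LinearMap.id : H →ₗ[k] H) j.toLinearMap))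
    (b : Module.Basis ι k R) : ∃ v, IsCoefficientMatrix j b v := by
  have key : ∀ t : H ⊗[k] R, ∃ y : ι → H,
      TensorProduct.map LinearMap.id j.toLinearMap t = ∑ a, y a ⊗ₜ[k] j (b a) := by
    intro t
    induction t with
    | zero => exact ⟨0, by simp⟩
    | add s t hs ht =>
      obtain ⟨y, hy⟩ := hs
      obtain ⟨z, hz⟩ := ht
      exact ⟨y + z, by simp [hy, hz, TensorProduct.add_tmul, Finset.sum_add_distrib]⟩
    | tmul h x =>
      refine ⟨fun a => b.repr x a • h, ?_⟩
      conv_lhs => rw [← b.sum_repr x]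
      simp only [TensorProduct.map_tmul, LinearMap.id_apply, AlgHom.toLinearMap_apply, map_sum,
        map_smul, TensorProduct.tmul_sum, TensorProduct.smul_tmul]
  have : ∀ i, ∃ y : ι → H,
      Coalgebra.comul (R := k) (j (b i)) = ∑ a, y a ⊗ₜ[k] j (b a) := by
    intro i
    obtain ⟨t, ht⟩ := hΔ (b i)
    rw [← ht]
    exact key t
  choose v hv using this
  exact ⟨v, hj, hv⟩

namespace IsCoefficientMatrix

variable {j : R →ₐ[k] H} {b : Module.Basis ι k R} {v : Matrix ι ι H}

theorem linearIndependent (hv : IsCoefficientMatrix j b v) :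
    LinearIndependent k fun a => j (b a) :=
  b.linearIndependent.map' j.toLinearMap (LinearMap.ker_eq_bot.2 hv.injective)

/-- Coassociativity at `j (b i)`, comparing coefficients of the independent elements `j (b a)`. -/
theorem comul_coeff (hv : IsCoefficientMatrix j b v) (i a : ι) :
    Coalgebra.comul (R := k) (v i a) = ∑ l, v i l ⊗ₜ[k] v l a := by
  have h := Coalgebra.coassoc_apply (R := k) (j (b i))
  rw [hv.comul_eq] at h
  simp only [map_sum, LinearMap.rTensor_tmul, LinearMap.lTensor_tmul, hv.comul_eq,
    TensorProduct.tmul_sum] at h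
  rw [Finset.sum_comm] at h
  have h' : ∑ a, Coalgebra.comul (R := k) (v i a) ⊗ₜ[k] j (b a) =
      ∑ a, (∑ l, v i l ⊗ₜ[k] v l a) ⊗ₜ[k] j (b a) := by
    apply (TensorProduct.assoc k H H H).injective
    simp only [map_sum, TensorProduct.sum_tmul, TensorProduct.assoc_tmul]
    exact h
  exact congrFun (eq_of_sum_tmul_eq hv.linearIndependent h') a

theorem sum_counit_smul (hv : IsCoefficientMatrix j b v) (i : ι) :
    ∑ a, Coalgebra.counit (R := k) (j (b a)) • v i a = j (b i) := by
  have h := Coalgebra.lTensor_counit_comul (R := k) (j (b i))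
  rw [hv.comul_eq] at h
  simpa [map_sum, ← Algebra.algebraMap_eq_smul_one] using congrArg (TensorProduct.rid k H) h

theorem counit_coeff [DecidableEq ι] (hv : IsCoefficientMatrix j b v) (i a : ι) :
    Coalgebra.counit (R := k) (v i a) = if i = a then 1 else 0 := by
  have h := Coalgebra.rTensor_counit_comul (R := k) (j (b i))
  rw [hv.comul_eq] at h
  have h' : ∑ a, Coalgebra.counit (R := k) (v i a) ⊗ₜ[k] j (b a) =
      ∑ a, (if i = a then (1 : k) else 0) ⊗ₜ[k] j (b a) := by
    simpa [map_sum, TensorProduct.ite_tmul] using h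
  exact congrFun (eq_of_sum_tmul_eq hv.linearIndependent h') a

theorem antipode_mul [DecidableEq ι] (hv : IsCoefficientMatrix j b v) :
    v.map (HopfAlgebra.antipode k) * v = 1 := by
  ext i a
  have h := HopfAlgebra.mul_antipode_rTensor_comul_apply (R := k) (v i a)
  rw [hv.comul_coeff, hv.counit_coeff] at h
  simpa [map_sum, Matrix.mul_apply, Matrix.one_apply, apply_ite] using h

theorem mul_antipode [DecidableEq ι] (hv : IsCoefficientMatrix j b v) :
    v * v.map (HopfAlgebra.antipode k) = 1 := by
  ext i a
  have h := HopfAlgebra.mul_antipode_lTensor_comul_apply (R := k) (v i a)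
  rw [hv.comul_coeff, hv.counit_coeff] at h
  simpa [map_sum, Matrix.mul_apply, Matrix.one_apply, apply_ite] using h

/-- Compatibility of the coefficients with the multiplication: apply a functional to the second
tensor factor of `Δ(xy) = Δ(x)Δ(y)`. -/
theorem sum_mul_smul (hv : IsCoefficientMatrix j b v) (φ : R →ₗ[k] k) (i l : ι) :
    ∑ a, ∑ c, φ (b a * b c) • (v i a * v l c) =
      ∑ a, b.repr (b i * b l) a • ∑ c, φ (b c) • v a c := by
  -- A linear retraction of `j` extends `φ` to a functional on `H`, so that it can be used for
  -- slicing.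
  obtain ⟨p, hp⟩ := j.toLinearMap.exists_leftInverse_of_injective
    (LinearMap.ker_eq_bot.2 hv.injective)
  have hp' : ∀ x, p (j x) = x := fun x => LinearMap.congr_fun hp x
  have hp2 : ∀ x y, p (j x * j y) = x * y := fun x y => by rw [← map_mul, hp']
  have h1 : Coalgebra.comul (R := k) (j (b i * b l)) =
      ∑ a, ∑ c, (v i a * v l c) ⊗ₜ[k] j (b a * b c) := by
    rw [map_mul, Bialgebra.comul_mul, hv.comul_eq, hv.comul_eq, Finset.sum_mul_sum]
    simp
  have h2 : Coalgebra.comul (R := k) (j (b i * b l)) =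
      ∑ a, b.repr (b i * b l) a • ∑ c, v a c ⊗ₜ[k] j (b c) := by
    conv_lhs => rw [← b.sum_repr (b i * b l)]
    simp only [map_sum, map_smul, hv.comul_eq]
  have h := congrArg (sliceRight (φ ∘ₗ p)) (h1.symm.trans h2)
  simpa [map_sum, hp', hp2] using h

/-- Invariance of a functional, in terms of coefficients. -/
theorem sum_smul_of_invariant (hv : IsCoefficientMatrix j b v) (ψ : H →ₗ[k] k)
    (hψ : ∀ h, sliceRight ψ (Coalgebra.comul (R := k) h) = algebraMap k H (ψ h)) (i : ι) :
    ∑ a, ψ (j (b a)) • v i a = algebraMap k H (ψ (j (b i))) := by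
  rw [← hψ, hv.comul_eq]
  simp

end IsCoefficientMatrix

end Coefficient

/-! ### Invariant functionals -/

/-- The left radical of the form `φ(xy)`. -/
def leftRadical {k R : Type*} [Field k] [Ring R] [Algebra k R] (φ : R →ₗ[k] k) : Ideal R where
  carrier := {x | ∀ y, φ (y * x) = 0}
  add_mem' hx hy z := by rw [mul_add, map_add, hx z, hy z, add_zero]
  zero_mem' y := by simp
  smul_mem' r x hx y := by rw [smul_eq_mul, ← mul_assoc]; exact hx _

theorem mem_leftRadical {k R : Type*} [Field k] [Ring R] [Algebra k R] {φ : R →ₗ[k] k} {x : R} :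
    x ∈ leftRadical φ ↔ ∀ y, φ (y * x) = 0 := Iff.rfl

/-- The character of the regular representation. -/
def regularTrace (k R : Type*) [Field k] [Ring R] [Algebra k R] : R →ₗ[k] k :=
  LinearMap.trace k R ∘ₗ LinearMap.mul k R

/-- The functional `φ` is invariant: `(id ⊗ φ)Δ(x) = φ(x)1`, expressed by means of the coefficient
matrix `v` with respect to the basis `b`. -/
def IsInvariantFunctional {k H R ι : Type*} [Field k] [Ring H] [Algebra k H] [Ring R] [Algebra k R]
    [Fintype ι] (b : Module.Basis ι k R) (v : Matrix ι ι H) (φ : R →ₗ[k] k) : Prop :=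
  ∀ i, ∑ a, φ (b a) • v i a = algebraMap k H (φ (b i))

namespace IsCoefficientMatrix

/-! ### The dichotomy for radicals of invariant functionals -/

section Ring

variable {k : Type*} [Field k] {H : Type*} [Ring H] [HopfAlgebra k H]
  {R : Type*} [Ring R] [Algebra k R] {ι : Type*} [Fintype ι]
  {j : R →ₐ[k] H} {b : Module.Basis ι k R} {v : Matrix ι ι H} {φ : R →ₗ[k] k}

/-- The Gram matrix of the form `φ(xy)`, with entries in `H`. -/
def gram (H : Type*) [Ring H] [Algebra k H] (b : Module.Basis ι k R) (φ : R →ₗ[k] k) :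
    Matrix ι ι H :=
  Matrix.of fun a c => algebraMap k H (φ (b a * b c))

/-- Multiplicativity of $\Delta$ makes the form $\varphi(xy)$ invariant under the coaction; the Gram
entries are scalars, so they move past those of `v`. -/
theorem mul_gram_mul (hv : IsCoefficientMatrix j b v) (hφ : IsInvariantFunctional b v φ) :
    v * gram H b φ * v.transpose = gram H b φ := by
  ext i l
  have h := hv.sum_mul_smul φ i l
  simp only [show ∀ i, ∑ a, φ (b a) • v i a = algebraMap k H (φ (b i)) from hφ] at h
  have h2 : ∑ a, b.repr (b i * b l) a • algebraMap k H (φ (b a)) =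
      algebraMap k H (φ (b i * b l)) := by
    conv_rhs => rw [← b.sum_repr (b i * b l)]
    simp only [map_sum, map_smul, smul_eq_mul, map_mul, Algebra.smul_def (A := H)]
  rw [h2] at h
  simp only [gram, Matrix.mul_apply, Matrix.transpose_apply, Matrix.of_apply, Finset.sum_mul]
  rw [Finset.sum_comm, ← h]
  refine Finset.sum_congr rfl fun a _ => Finset.sum_congr rfl fun c _ => ?_
  rw [← Algebra.commutes, Algebra.smul_def, mul_assoc]

theorem antipode_mul_gram [DecidableEq ι] (hv : IsCoefficientMatrix j b v)
    (hφ : IsInvariantFunctional b v φ) :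
    v.map (HopfAlgebra.antipode k) * gram H b φ = gram H b φ * v.transpose := by
  conv_lhs => rw [← hv.mul_gram_mul hφ]
  rw [← mul_assoc, ← mul_assoc, hv.antipode_mul, one_mul]

/-- The radical of an invariant functional is a left coideal. -/
theorem sum_mem_leftRadical (hv : IsCoefficientMatrix j b v) (hφ : IsInvariantFunctional b v φ) {x : R}
    (hx : x ∈ leftRadical φ) (f : H →ₗ[k] k) :
    ∑ a, f (∑ i, b.repr x i • v i a) • b a ∈ leftRadical φ := by
  classical
  -- By `antipode_mul_gram`, coacting on the right argument of the form amounts to coacting on the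
  -- left one through the antipode; there `x` is untouched and pairs to zero.
  have key : ∀ l, ∑ a, φ (b l * b a) • ∑ i, b.repr x i • v i a = 0 := by
    intro l
    have h : ∀ i, ∑ a, φ (b l * b a) • v i a =
        ∑ c, φ (b c * b i) • HopfAlgebra.antipode k (v l c) := by
      intro i
      have h := congrFun (congrFun (hv.antipode_mul_gram hφ) l) i
      simp only [gram, Matrix.mul_apply, Matrix.map_apply, Matrix.of_apply,
        Matrix.transpose_apply, ← Algebra.commutes (R := k)] at h
      simpa only [Algebra.smul_def] using h.symm
    calc ∑ a, φ (b l * b a) • ∑ i, b.repr x i • v i a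
        = ∑ i, b.repr x i • ∑ a, φ (b l * b a) • v i a := by
          simp only [Finset.smul_sum]
          rw [Finset.sum_comm]
          simp only [smul_comm (φ _)]
      _ = ∑ c, (∑ i, b.repr x i * φ (b c * b i)) • HopfAlgebra.antipode k (v l c) := by
          simp only [h, Finset.smul_sum, Finset.sum_smul, mul_smul]
          rw [Finset.sum_comm]
      _ = 0 := by
          refine Finset.sum_eq_zero fun c _ => ?_
          have h0 : φ (b c * x) = 0 := hx _
          rw [← b.sum_repr x] at h0
          simp only [Finset.mul_sum, map_sum, mul_smul_comm, map_smul, smul_eq_mul] at h0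
          rw [h0, zero_smul]
  rw [mem_leftRadical]
  intro y
  rw [← b.sum_repr y]
  simp only [Finset.sum_mul, map_sum, smul_mul_assoc, map_smul (φ : R →ₗ[k] k)]
  refine Finset.sum_eq_zero fun l _ => ?_
  have h := congrArg f (key l)
  simp only [map_sum, map_smul, map_zero, smul_eq_mul] at h
  simp only [Finset.mul_sum, map_sum, map_smul, mul_smul_comm, smul_eq_mul]
  simp only [Finset.mul_sum] at h
  rw [← Finset.mul_sum]
  convert mul_zero _
  rw [← h]
  simp only [Finset.sum_mul]
  refine Finset.sum_congr rfl fun a _ => Finset.sum_congr rfl fun i _ => ?_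
  ring

/-- The radical of an invariant functional vanishes or generates `H` as a left ideal. -/
theorem leftRadical_eq_bot_or [FiniteDimensional k H] (hv : IsCoefficientMatrix j b v)
    (hφ : IsInvariantFunctional b v φ) :
    leftRadical φ = ⊥ ∨ (1 : H) ∈ Ideal.span (j '' (leftRadical φ : Set R)) := by
  classical
  by_cases hε : ∃ x ∈ leftRadical φ, Coalgebra.counit (R := k) (j x) ≠ 0
  · right
    obtain ⟨x, hx, hεx⟩ := hε
    set y : ι → H := fun a => ∑ i, b.repr x i • v i a with hy
    -- This is $S(x_1)x_2=\epsilon(x)1$. As the radical is a left coideal, $x_2$ can be taken in it,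
    -- so a nonzero scalar lies in the left ideal.
    have h1 : ∑ a, HopfAlgebra.antipode k (y a) * j (b a) =
        algebraMap k H (Coalgebra.counit (R := k) (j x)) := by
      rw [← HopfAlgebra.mul_antipode_rTensor_comul_apply (R := k) (j x)]
      conv_rhs => rw [← b.sum_repr x]
      simp only [hy, map_sum, map_smul, hv.comul_eq, LinearMap.rTensor_tmul,
        LinearMap.mul'_apply, Finset.smul_sum, Finset.sum_mul, smul_mul_assoc]
      rw [Finset.sum_comm]
    let B := Module.finBasis k H
    have h2 : ∑ a, HopfAlgebra.antipode k (y a) * j (b a) =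
        ∑ t, HopfAlgebra.antipode k (B t) * j (∑ a, B.coord t (y a) • b a) := by
      simp only [map_sum, map_smul, Finset.mul_sum, mul_smul_comm]
      rw [Finset.sum_comm]
      refine Finset.sum_congr rfl fun a _ => ?_
      conv_lhs => rw [← B.sum_repr (y a)]
      simp only [map_sum, map_smul, Finset.sum_mul, smul_mul_assoc, Module.Basis.coord_apply]
    have h3 : algebraMap k H (Coalgebra.counit (R := k) (j x)) ∈
        Ideal.span (j '' (leftRadical φ : Set R)) := by
      rw [← h1, h2]
      exact Submodule.sum_mem _ fun t _ => Ideal.mul_mem_left _ _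
        (Ideal.subset_span ⟨_, hv.sum_mem_leftRadical hφ hx _, rfl⟩)
    have h4 := Ideal.mul_mem_left _
      (algebraMap k H (Coalgebra.counit (R := k) (j x))⁻¹) h3
    rwa [← map_mul, inv_mul_cancel₀ hεx, map_one] at h4
  · left
    push Not at hε
    rw [eq_bot_iff]
    intro x hx
    rw [Submodule.mem_bot, ← map_eq_zero_iff j hv.injective,
      ← Module.forall_dual_apply_eq_zero_iff k]
    intro f
    -- The counit kills every slice of $\Delta(x)$ in the radical, and $x=x_1\epsilon(x_2)$.
    have h := hε _ (hv.sum_mem_leftRadical hφ hx f)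
    simp only [map_sum, map_smul, smul_eq_mul] at h
    have h2 : j x = ∑ i, b.repr x i • ∑ a, Coalgebra.counit (R := k) (j (b a)) • v i a := by
      conv_lhs => rw [← b.sum_repr x]
      simp only [map_sum, map_smul, hv.sum_counit_smul]
    rw [← h, h2]
    simp only [map_sum, map_smul, smul_eq_mul, Finset.mul_sum, Finset.sum_mul]
    rw [Finset.sum_comm]
    refine Finset.sum_congr rfl fun a _ => Finset.sum_congr rfl fun i _ => ?_
    ring

end Ring

/-! ### Nondegeneracy in the commutative case -/

section CommRing

variable {k : Type*} [Field k] {H : Type*} [Ring H] [HopfAlgebra k H]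
  {R : Type*} [CommRing R] [Algebra k R] {ι : Type*} [Fintype ι]
  {j : R →ₐ[k] H} {b : Module.Basis ι k R} {v : Matrix ι ι H} {φ : R →ₗ[k] k}

/-- A proper ideal of a commutative subalgebra of a finite-dimensional algebra `H` does not
generate `H` as a left ideal. -/
theorem _root_.Ideal.eq_top_of_one_mem_span_image {k H R : Type*} [Field k] [Ring H] [Algebra k H]
    [FiniteDimensional k H] [CommRing R] [Algebra k R] (j : R →ₐ[k] H)
    (hj : Function.Injective j) (I : Ideal R) (h1 : (1 : H) ∈ Ideal.span (j '' (I : Set R))) :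
    I = ⊤ := by
  -- `H` becomes a finite `R`-module by right multiplication; commutativity of `R` makes this a left
  -- action.
  let f : R →+* Hᵐᵒᵖ :=
    { toFun r := MulOpposite.op (j r)
      map_one' := by simp
      map_mul' r s := by rw [mul_comm, map_mul, MulOpposite.op_mul]
      map_zero' := by simp
      map_add' := by simp }
  let _ : Module R H := Module.compHom H f
  have hsmul : ∀ (r : R) (h : H), r • h = h * j r := fun r h => rfl
  have : IsScalarTower k R H := ⟨fun c r h => by simp [hsmul]⟩
  have hfin : Module.Finite R H := Module.Finite.of_restrictScalars_finite k R H
  have htop : ∀ g : H, g ∈ I • (⊤ : Submodule R H) := by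
    intro g
    suffices ∀ m ∈ Ideal.span (j '' (I : Set R)), g * m ∈ I • (⊤ : Submodule R H) by
      simpa using this 1 h1
    intro m hm
    induction hm using Submodule.span_induction generalizing g with
    | mem x hx =>
      obtain ⟨r, hr, rfl⟩ := hx
      exact Submodule.smul_mem_smul hr (Submodule.mem_top (x := g))
    | zero => simp
    | add x y _ _ hx hy => rw [mul_add]; exact Submodule.add_mem _ (hx g) (hy g)
    | smul a x _ hx => rw [smul_eq_mul, ← mul_assoc]; exact hx _
  -- Nakayama: since $I\cdot H=H$, some $r\equiv 1$ modulo $I$ annihilates `H`. Acting on $1$ gives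
  -- $j(r)=0$, so $r=0$ and $1\in I$.
  obtain ⟨r, hr, hr0⟩ := Submodule.exists_sub_one_mem_and_smul_eq_zero_of_fg_of_le_smul I
    (⊤ : Submodule R H) hfin.fg_top fun g _ => htop g
  have h0 : r = 0 := by
    have := hr0 1 trivial
    rw [hsmul, one_mul] at this
    exact (map_eq_zero_iff j hj).1 this
  rw [Ideal.eq_top_iff_one]
  simpa [h0] using I.neg_mem hr

theorem leftRadical_eq_bot [FiniteDimensional k H] (hv : IsCoefficientMatrix j b v)
    (hφ : IsInvariantFunctional b v φ) (h1 : φ 1 ≠ 0) : leftRadical φ = ⊥ := by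
  refine (hv.leftRadical_eq_bot_or hφ).resolve_right fun h => h1 ?_
  have htop := Ideal.eq_top_of_one_mem_span_image j hv.injective _ h
  have : (1 : R) ∈ leftRadical φ := htop ▸ Submodule.mem_top
  simpa using this 1

/-- If a commutative left coideal subalgebra has an invariant functional that does not vanish
at `1`, then the squared antipode is trivial on its coefficients. -/
theorem transpose_mul_antipode_transpose [DecidableEq ι] [FiniteDimensional k H]
    (hv : IsCoefficientMatrix j b v) (hφ : IsInvariantFunctional b v φ) (h1 : φ 1 ≠ 0) :
    v.transpose * (v.map (HopfAlgebra.antipode k)).transpose = 1 := by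
  let G₀ : Matrix ι ι k := Matrix.of fun a c => φ (b a * b c)
  have hG₀ : IsUnit G₀ := by
    rw [← Matrix.mulVec_injective_iff_isUnit]
    intro x y hxy
    have hz : G₀.mulVec (x - y) = 0 := by rw [Matrix.mulVec_sub, hxy, sub_self]
    have hmem : ∑ a, (x - y) a • b a ∈ leftRadical φ := by
      intro z
      rw [← b.sum_repr z, Finset.sum_mul, map_sum]
      refine Finset.sum_eq_zero fun l _ => ?_
      have h := congrFun hz l
      simp only [G₀, Matrix.mulVec, dotProduct, Matrix.of_apply, Pi.zero_apply] at h
      rw [smul_mul_assoc, map_smul, Finset.mul_sum, map_sum]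
      simp only [mul_smul_comm, map_smul, smul_eq_mul, mul_comm _ (φ _)]
      rw [h, mul_zero]
    rw [hv.leftRadical_eq_bot hφ h1, Submodule.mem_bot] at hmem
    rw [← sub_eq_zero]
    funext a
    exact Fintype.linearIndependent_iff.1 b.linearIndependent _ hmem a
  have hG : IsUnit (gram H b φ) := hG₀.map (algebraMap k H).mapMatrix
  have e1 := hv.antipode_mul_gram hφ
  -- Entrywise `e1` again: the Gram matrix is symmetric because `R` is commutative, and its entries
  -- are central.
  have e2 : gram H b φ * (v.map (HopfAlgebra.antipode k)).transpose = v * gram H b φ := by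
    ext i l
    have h := congrFun (congrFun e1 l) i
    simp only [gram, Matrix.mul_apply, Matrix.map_apply, Matrix.of_apply,
      Matrix.transpose_apply, mul_comm (b l), ← Algebra.commutes (R := k)] at h ⊢
    simpa only [mul_comm (b i)] using h
  -- $G\,v^tS(v)^t=S(v)\,G\,S(v)^t=S(v)\,v\,G=G$.
  refine hG.mul_left_cancel ?_
  rw [← mul_assoc, ← e1, mul_assoc, e2, ← mul_assoc, hv.antipode_mul, one_mul, mul_one]

end CommRing

/-! ### Invariance of the regular trace -/

section Trace

variable {k : Type*} [Field k] {H : Type*} [Ring H] [HopfAlgebra k H]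
  {R : Type*} [Ring R] [Algebra k R] {ι : Type*} [Fintype ι] [DecidableEq ι]
  {j : R →ₐ[k] H} {b : Module.Basis ι k R} {v : Matrix ι ι H}

/-- The trace of the regular representation is invariant if the squared antipode is trivial on the
coefficients. -/
theorem isInvariantFunctional_trace (hv : IsCoefficientMatrix j b v)
    (hS : v.transpose * (v.map (HopfAlgebra.antipode k)).transpose = 1) :
    IsInvariantFunctional b v (regularTrace k R) := by
  have htr : ∀ x, regularTrace k R (b x) = ∑ i, b.coord i (b x * b i) := by
    intro x
    rw [regularTrace, LinearMap.comp_apply, LinearMap.trace_eq_matrix_trace k b]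
    simp [Matrix.trace, LinearMap.toMatrix_apply]
  have hS' : ∀ a m, ∑ i, v i a * HopfAlgebra.antipode k (v m i) = if a = m then 1 else 0 := by
    intro a m
    have h := congrFun (congrFun hS a) m
    simpa [Matrix.mul_apply, Matrix.one_apply] using h
  have hS2 : ∀ l i, ∑ m, v l m * HopfAlgebra.antipode k (v m i) = if l = i then 1 else 0 := by
    intro l i
    have h := congrFun (congrFun hv.mul_antipode l) i
    simpa [Matrix.mul_apply, Matrix.one_apply] using h
  intro x
  -- Insert $\sum_i v_{ia}S(v_{mi})=\delta_{am}$, which is the hypothesis `hS`, and use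
  -- multiplicativity of the coaction. Summing over `m` then collapses $\sum_m v_{lm}S(v_{mi})$ to
  -- $\delta_{li}$, which leaves the trace of $b_x$.
  have h5 : ∀ m, ∑ c, b.coord m (b c * b m) • v x c =
      ∑ i, ∑ l, b.repr (b x * b i) l • (v l m * HopfAlgebra.antipode k (v m i)) := by
    intro m
    have h : ∀ i, ∑ c, ∑ a, b.coord m (b c * b a) • (v x c * v i a) =
        ∑ l, b.repr (b x * b i) l • v l m := by
      intro i
      rw [hv.sum_mul_smul]
      simp [Finsupp.single_apply, ite_smul]
    calc ∑ c, b.coord m (b c * b m) • v x c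
        = ∑ c, ∑ a, b.coord m (b c * b a) • (v x c *
            ∑ i, v i a * HopfAlgebra.antipode k (v m i)) := by
          simp [hS']
      _ = ∑ i, (∑ c, ∑ a, b.coord m (b c * b a) • (v x c * v i a)) *
            HopfAlgebra.antipode k (v m i) := by
          simp only [Finset.mul_sum, Finset.smul_sum, Finset.sum_mul, smul_mul_assoc, mul_assoc]
          rw [Finset.sum_congr rfl fun c _ => Finset.sum_comm, Finset.sum_comm]
      _ = _ := by
          simp only [h, Finset.sum_mul, smul_mul_assoc]
  simp only [htr, Finset.sum_smul]
  rw [Finset.sum_comm, Finset.sum_congr rfl fun m _ => h5 m, Finset.sum_comm]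
  rw [map_sum]
  refine Finset.sum_congr rfl fun i _ => ?_
  rw [Finset.sum_comm]
  simp only [← Finset.smul_sum, hS2]
  simp [Algebra.algebraMap_eq_smul_one]

end Trace

end IsCoefficientMatrix

/-! ### Magic corepresentations -/

/-- A magic matrix with entries in a Hopf algebra that is a corepresentation. -/
structure IsMagicCorepresentation (k : Type*) [Field k] {H : Type*} [Ring H] [HopfAlgebra k H]
    {ι : Type*} [Fintype ι] [DecidableEq ι] (v : Matrix ι ι H) : Prop where
  row_mul : ∀ i j l, v i j * v i l = if j = l then v i j else 0
  col_mul : ∀ i j l, v i j * v l j = if i = l then v i j else 0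
  row_sum : ∀ i, ∑ l, v i l = 1
  col_sum : ∀ i, ∑ l, v l i = 1
  comul : ∀ i j, Coalgebra.comul (R := k) (v i j) = ∑ l, v i l ⊗ₜ[k] v l j
  counit : ∀ i j, Coalgebra.counit (R := k) (v i j) = if i = j then 1 else 0

namespace IsMagicCorepresentation

variable {k : Type*} [Field k] {H : Type*} [Ring H] [HopfAlgebra k H]
  {ι κ : Type*} [Fintype ι] [DecidableEq ι] [Fintype κ] [DecidableEq κ]

theorem reindex {v : Matrix ι ι H} (hv : IsMagicCorepresentation k v) (e : ι ≃ κ) :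
    IsMagicCorepresentation k (v.submatrix e.symm e.symm) where
  row_mul i j l := by simp [hv.row_mul]
  col_mul i j l := by simp [hv.col_mul]
  row_sum i := by
    rw [← hv.row_sum (e.symm i)]; exact e.symm.sum_comp fun l => v (e.symm i) l
  col_sum i := by
    rw [← hv.col_sum (e.symm i)]; exact e.symm.sum_comp fun l => v l (e.symm i)
  comul i j := by
    simp only [Matrix.submatrix_apply, hv.comul]
    exact (e.symm.sum_comp fun l => v (e.symm i) l ⊗ₜ[k] v l (e.symm j)).symm
  counit i j := by simp [hv.counit]

/-- Sizes add under block sums, which is where the sum in the degree bound comes from. -/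
theorem fromBlocks {v : Matrix ι ι H} (hv : IsMagicCorepresentation k v) {w : Matrix κ κ H}
    (hw : IsMagicCorepresentation k w) :
    IsMagicCorepresentation k (Matrix.fromBlocks v 0 0 w) where
  row_mul i j l := by
    rcases i with i | i <;> rcases j with j | j <;> rcases l with l | l <;>
      simp [hv.row_mul, hw.row_mul]
  col_mul i j l := by
    rcases i with i | i <;> rcases j with j | j <;> rcases l with l | l <;>
      simp [hv.col_mul, hw.col_mul]
  row_sum i := by rcases i with i | i <;> simp [hv.row_sum, hw.row_sum]
  col_sum i := by rcases i with i | i <;> simp [hv.col_sum, hw.col_sum]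
  comul i j := by
    rcases i with i | i <;> rcases j with j | j <;> simp [hv.comul, hw.comul]
  counit i j := by
    rcases i with i | i <;> rcases j with j | j <;> simp [hv.counit, hw.counit]

theorem isMagic {n : ℕ} {v : Matrix (Fin n) (Fin n) H} (hv : IsMagicCorepresentation k v) :
    IsMagic v :=
  ⟨hv.row_mul, hv.col_mul, hv.row_sum, hv.col_sum⟩

/-- The Hopf algebra map `𝒜ₛ(n) → H` defined by a magic corepresentation of size `n`. -/
def toBialgHom {n : ℕ} {v : Matrix (Fin n) (Fin n) H} (hv : IsMagicCorepresentation k v) :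
    QPerm k n →ₐc[k] H :=
  BialgHom.ofAlgHom (QPerm.lift v hv.isMagic)
    (QPerm.hom_ext fun i j => by
      simp [QPerm.counit_u, QPerm.lift_u (k := k) v hv.isMagic, hv.counit])
    (QPerm.hom_ext fun i j => by
      simp [QPerm.comul_u, QPerm.lift_u (k := k) v hv.isMagic, hv.comul])

@[simp]
theorem toBialgHom_u {n : ℕ} {v : Matrix (Fin n) (Fin n) H} (hv : IsMagicCorepresentation k v)
    (i j : Fin n) : hv.toBialgHom (QPerm.u k i j) = v i j :=
  QPerm.lift_u v hv.isMagic i j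

theorem of_bialgHom {n : ℕ} (f : QPerm k n →ₐc[k] H) :
    IsMagicCorepresentation k (Matrix.of fun i j => f (QPerm.u k i j)) where
  row_mul i j l := by
    simp [← map_mul, (QPerm.isMagic_u k).row_mul, apply_ite f]
  col_mul i j l := by
    simp [← map_mul, (QPerm.isMagic_u k).col_mul, apply_ite f]
  row_sum i := by simp [← map_sum, (QPerm.isMagic_u k).row_sum]
  col_sum i := by simp [← map_sum, (QPerm.isMagic_u k).col_sum]
  comul i j := by
    simp [← CoalgHomClass.map_comp_comul_apply, QPerm.comul_u]
  counit i j := by simp [QPerm.counit_u]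

/-- A magic corepresentation is inverted by its transpose. -/
theorem antipode_apply {v : Matrix ι ι H} (hv : IsMagicCorepresentation k v) (i j : ι) :
    HopfAlgebra.antipode k (v i j) = v j i := by
  have h1 : v.map (HopfAlgebra.antipode k) * v = 1 := by
    ext i a
    have h := HopfAlgebra.mul_antipode_rTensor_comul_apply (R := k) (v i a)
    rw [hv.comul, hv.counit] at h
    simpa [map_sum, Matrix.mul_apply, Matrix.one_apply, apply_ite] using h
  have h2 : v * v.transpose = 1 := by
    ext i a
    simp only [Matrix.mul_apply, Matrix.transpose_apply, hv.col_mul, Matrix.one_apply]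
    split_ifs with h
    · exact hv.row_sum i
    · simp
  have h3 : v.map (HopfAlgebra.antipode k) = v.transpose := left_inv_eq_right_inv h1 h2
  exact congrFun (congrFun h3 i) j

/-- The squared antipode is multiplicative and, since the antipode transposes `v`, fixes the
generators. -/
theorem antipode_antipode_of_adjoin_eq_top {v : Matrix ι ι H}
    (hv : IsMagicCorepresentation k v)
    (htop : Algebra.adjoin k (Set.range fun p : ι × ι => v p.1 p.2) = ⊤) (x : H) :
    HopfAlgebra.antipode k (HopfAlgebra.antipode k x) = x := by
  have hx : x ∈ Algebra.adjoin k (Set.range fun p : ι × ι => v p.1 p.2) := htop ▸ trivial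
  induction hx using Algebra.adjoin_induction with
  | mem x hx =>
    obtain ⟨p, rfl⟩ := hx
    simp [hv.antipode_apply]
  | algebraMap r => simp [Algebra.algebraMap_eq_smul_one, HopfAlgebra.antipode_one]
  | add x y _ _ hx hy => simp [hx, hy]
  | mul x y _ _ hx hy => simp [HopfAlgebra.antipode_mul_antidistrib, hx, hy]

end IsMagicCorepresentation

/-! ### Commutative left coideal subalgebras -/

/-- A reduced Artinian ring is the product of its residue fields, each equal to $k$ by algebraic
closedness; the basis is that of unit vectors. -/
theorem exists_basis_orthogonal_idempotents (k R : Type*) [Field k] [IsAlgClosed k] [CommRing R]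
    [Algebra k R] [FiniteDimensional k R] [IsReduced R] :
    ∃ b : Module.Basis (Fin (Module.finrank k R)) k R,
      (∀ i j, b i * b j = if i = j then b i else 0) ∧ ∑ i, b i = 1 := by
  classical
  have : IsArtinianRing R := IsArtinianRing.of_finite k R
  let _ : Fintype (MaximalSpectrum R) := Fintype.ofFinite _
  let _ (I : MaximalSpectrum R) : Field (R ⧸ I.asIdeal) := Ideal.Quotient.field _
  let e₁ (I : MaximalSpectrum R) : k ≃ₐ[k] R ⧸ I.asIdeal :=
    AlgEquiv.ofBijective (Algebra.ofId k _) IsAlgClosed.algebraMap_bijective_of_isIntegral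
  let e : R ≃ₐ[k] (MaximalSpectrum R → k) :=
    ((IsArtinianRing.equivPi R).restrictScalars k).trans (AlgEquiv.piCongrRight e₁).symm
  let b₀ : Module.Basis (MaximalSpectrum R) k R := Module.Basis.ofEquivFun e.toLinearEquiv
  have hb₀ : ∀ i, b₀ i = e.symm (Pi.single i 1) := fun i => by
    simp [b₀, Module.Basis.coe_ofEquivFun]
  let r : MaximalSpectrum R ≃ Fin (Module.finrank k R) :=
    Fintype.equivFinOfCardEq (Module.finrank_eq_card_basis b₀).symm
  refine ⟨b₀.reindex r, fun i j => ?_, ?_⟩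
  · simp only [Module.Basis.reindex_apply, hb₀, ← map_mul, ← Pi.single_mul_left]
    by_cases h : i = j
    · subst h; simp
    · have : r.symm i ≠ r.symm j := fun h' => h (r.symm.injective h')
      simp [h, this, Pi.single_eq_of_ne]
  · simp only [Module.Basis.reindex_apply]
    rw [r.symm.sum_comp fun i => b₀ i]
    simp only [hb₀, ← map_sum]
    rw [Finset.univ_sum_single (fun _ : MaximalSpectrum R => (1 : k))]
    exact map_one e.symm

section Coideal

variable {k : Type*} [Field k] {H : Type*} [Ring H] [HopfAlgebra k H] [FiniteDimensional k H]

theorem regularTrace_one {k R : Type*} [Field k] [Ring R] [Algebra k R] [FiniteDimensional k R] :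
    regularTrace k R 1 = Module.finrank k R := by
  have : LinearMap.mul k R 1 = LinearMap.id := by ext; simp
  rw [regularTrace, LinearMap.comp_apply, this]
  simp

theorem regularTrace_one_ne_zero {k R : Type*} [Field k] [CharZero k] [Ring R] [Nontrivial R]
    [Algebra k R] [FiniteDimensional k R] : regularTrace k R 1 ≠ 0 := by
  rw [regularTrace_one]
  exact_mod_cast Module.finrank_pos.ne'

/-- A commutative left coideal subalgebra of a finite-dimensional Hopf algebra with a normalized
left integral in the dual has no nilpotent elements. -/
theorem isReduced_of_coideal [CharZero k] {R : Type*} [CommRing R] [Algebra k R]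
    (j : R →ₐ[k] H) (hj : Function.Injective j)
    (hΔ : ∀ x, Coalgebra.comul (R := k) (j x) ∈
      LinearMap.range (TensorProduct.map (LinearMap.id : H →ₗ[k] H) j.toLinearMap))
    (ψ : H →ₗ[k] k) (hψ1 : ψ 1 = 1)
    (hψ : ∀ h, sliceRight ψ (Coalgebra.comul (R := k) h) = algebraMap k H (ψ h)) :
    IsReduced R := by
  have hfin : FiniteDimensional k R := Module.Finite.of_injective j.toLinearMap hj
  have : Nontrivial H := (Bialgebra.counitAlgHom k H).toRingHom.domain_nontrivial
  have : Nontrivial R := j.toRingHom.domain_nontrivial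
  obtain ⟨v, hv⟩ := exists_isCoefficientMatrix j hj hΔ (Module.finBasis k R)
  have hφ : IsInvariantFunctional (Module.finBasis k R) v (ψ ∘ₗ j.toLinearMap) :=
    hv.sum_smul_of_invariant ψ hψ
  have htr := hv.isInvariantFunctional_trace
    (hv.transpose_mul_antipode_transpose hφ (by simp [hψ1]))
  have hrad := hv.leftRadical_eq_bot htr regularTrace_one_ne_zero
  refine ⟨fun x hx => ?_⟩
  rw [← Submodule.mem_bot R, ← hrad]
  intro y
  -- For nilpotent $x$, each $yx$ is nilpotent by commutativity and has trace zero, so $x$ lies in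
  -- the radical of the trace form.
  have hn : IsNilpotent (LinearMap.mul k R (y * x)) :=
    ((Commute.all y x).isNilpotent_mul_left hx).map (Algebra.lmul k R)
  exact (LinearMap.isNilpotent_trace_of_isNilpotent hn).eq_zero

/-- The coefficients of a commutative left coideal subalgebra with respect to the basis of its
minimal idempotents form a magic corepresentation. -/
theorem exists_isMagicCorepresentation_of_coideal [IsAlgClosed k] [CharZero k] {R : Type*}
    [CommRing R] [Algebra k R] (j : R →ₐ[k] H) (hj : Function.Injective j)
    (hΔ : ∀ x, Coalgebra.comul (R := k) (j x) ∈
      LinearMap.range (TensorProduct.map (LinearMap.id : H →ₗ[k] H) j.toLinearMap))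
    (ψ : H →ₗ[k] k) (hψ1 : ψ 1 = 1)
    (hψ : ∀ h, sliceRight ψ (Coalgebra.comul (R := k) h) = algebraMap k H (ψ h)) :
    ∃ v : Matrix (Fin (Module.finrank k R)) (Fin (Module.finrank k R)) H,
      IsMagicCorepresentation k v ∧
        ∀ x, j x ∈ Algebra.adjoin k (Set.range fun p : _ × _ => v p.1 p.2) := by
  have hfin : FiniteDimensional k R := Module.Finite.of_injective j.toLinearMap hj
  have hred := isReduced_of_coideal j hj hΔ ψ hψ1 hψ
  obtain ⟨b, hb, hb1⟩ := exists_basis_orthogonal_idempotents k R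
  obtain ⟨v, hv⟩ := exists_isCoefficientMatrix j hj hΔ b
  have hφ : IsInvariantFunctional b v (ψ ∘ₗ j.toLinearMap) := hv.sum_smul_of_invariant ψ hψ
  have htr := hv.isInvariantFunctional_trace
    (hv.transpose_mul_antipode_transpose hφ (by simp [hψ1]))
  -- Multiplication by a minimal idempotent has rank one. Invariance of the trace thus reads as row
  -- sums equal to $1$, which `ψ`, with unknown values on the idempotents, would not give.
  have htr1 : ∀ i, regularTrace k R (b i) = 1 := by
    intro i
    rw [regularTrace, LinearMap.comp_apply, LinearMap.trace_eq_matrix_trace k b]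
    have h : ∀ x, b.repr (b i * b x) x = if i = x then 1 else 0 := by
      intro x
      rw [hb]
      split_ifs with h
      · subst h; simp
      · simp
    simp [Matrix.trace, LinearMap.toMatrix_apply, h]
  have hrow : ∀ i, ∑ l, v i l = 1 := fun i => by simpa [htr1] using htr i
  -- Apply $\Delta$ to $b_ib_l=\delta_{il}b_i$ and compare coefficients.
  have hcm : ∀ i a l, v i a * v l a = if i = l then v i a else 0 := by
    intro i a l
    have h : ∑ a, (v i a * v l a) ⊗ₜ[k] j (b a) =
        ∑ a, (if i = l then v i a else 0) ⊗ₜ[k] j (b a) := by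
      have h0 : Coalgebra.comul (R := k) (j (b i * b l)) =
          ∑ a, (v i a * v l a) ⊗ₜ[k] j (b a) := by
        rw [map_mul, Bialgebra.comul_mul, hv.comul_eq, hv.comul_eq, Finset.sum_mul_sum]
        simp [← map_mul, hb, apply_ite j, TensorProduct.tmul_ite]
      rw [← h0, hb]
      split_ifs
      · exact hv.comul_eq i
      · simp
    exact congrFun (eq_of_sum_tmul_eq hv.linearIndependent h) a
  have hcs : ∀ i, ∑ l, v l i = 1 := by
    intro i
    have h : ∑ a, (∑ l, v l a) ⊗ₜ[k] j (b a) = ∑ a, (1 : H) ⊗ₜ[k] j (b a) := by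
      simp only [TensorProduct.sum_tmul]
      rw [Finset.sum_comm]
      simp only [← hv.comul_eq, ← map_sum, ← TensorProduct.tmul_sum, hb1, map_one,
        Bialgebra.comul_one]
      rfl
    exact congrFun (eq_of_sum_tmul_eq hv.linearIndependent h) i
  have hS : ∀ i m, HopfAlgebra.antipode k (v i m) = v m i := by
    have h2 : v * v.transpose = 1 := by
      ext i a
      simp only [Matrix.mul_apply, Matrix.transpose_apply, hcm, Matrix.one_apply]
      split_ifs with h
      · exact hrow i
      · simp
    intro i m
    have h3 : v.map (HopfAlgebra.antipode k) = v.transpose :=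
      left_inv_eq_right_inv hv.antipode_mul h2
    exact congrFun (congrFun h3 i) m
  refine ⟨v, ⟨fun i a l => ?_, hcm, hrow, hcs, hv.comul_coeff, hv.counit_coeff⟩, fun x => ?_⟩
  -- The antipode transposes `v` and reverses products, so it carries column orthogonality to row
  -- orthogonality.
  · rw [← hS, ← hS l, ← HopfAlgebra.antipode_mul_antidistrib, hcm]
    by_cases h : a = l
    · subst h; simp
    · simp [h, Ne.symm h]
  · rw [← b.sum_repr x, map_sum]
    refine Subalgebra.sum_mem _ fun i _ => ?_
    rw [map_smul, ← hv.sum_counit_smul]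
    exact Subalgebra.smul_mem _ (Subalgebra.sum_mem _ fun a _ =>
      Subalgebra.smul_mem _ (Algebra.subset_adjoin (Set.mem_range_self (i, a))) _) _

end Coideal

/-! ### Integrals on involutory Hopf algebras -/

section Involutory

variable {k : Type*} [Field k] {H : Type*} [Ring H] [HopfAlgebra k H]

variable (k H) in
/-- The map `x ⊗ y ↦ y S(x)`. -/
def flipMulAntipode : H ⊗[k] H →ₗ[k] H :=
  LinearMap.mul' k H ∘ₗ (HopfAlgebra.antipode k).lTensor H ∘ₗ
    (TensorProduct.comm k H H).toLinearMap

@[simp]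
theorem flipMulAntipode_tmul (x y : H) :
    flipMulAntipode k H (x ⊗ₜ[k] y) = y * HopfAlgebra.antipode k x := by
  simp [flipMulAntipode]

/-- When $S^2=\mathrm{id}$, $x_2S(x_1)=S(x_1S(x_2))=\epsilon(x)1$. -/
theorem flipMulAntipode_comul
    (hS : ∀ x : H, HopfAlgebra.antipode k (HopfAlgebra.antipode k x) = x) (x : H) :
    flipMulAntipode k H (Coalgebra.comul (R := k) x) =
      algebraMap k H (Coalgebra.counit (R := k) x) := by
  have key : ∀ s : H ⊗[k] H, flipMulAntipode k H s = HopfAlgebra.antipode k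
      (LinearMap.mul' k H ((HopfAlgebra.antipode k).lTensor H s)) := by
    intro s
    induction s with
    | zero => simp
    | add s t hs ht => simp [hs, ht]
    | tmul a b => simp [HopfAlgebra.antipode_mul_antidistrib, hS]
  rw [key, HopfAlgebra.mul_antipode_lTensor_comul_apply]
  simp [Algebra.algebraMap_eq_smul_one, HopfAlgebra.antipode_one]

/-- On a finite-dimensional involutory Hopf algebra in characteristic zero, the character of the
regular representation is an integral whose associated form is nondegenerate. -/
theorem exists_regularTrace_mul_eq_counit [CharZero k] [FiniteDimensional k H]
    (hS : ∀ x : H, HopfAlgebra.antipode k (HopfAlgebra.antipode k x) = x) :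
    (∀ x : H, sliceRight (regularTrace k H) (Coalgebra.comul (R := k) x) =
      algebraMap k H (regularTrace k H x)) ∧
    ∃ y : H, ∀ x : H, regularTrace k H (x * y) = Coalgebra.counit (R := k) x := by
  have : Nontrivial H := (Bialgebra.counitAlgHom k H).toRingHom.domain_nontrivial
  let b := Module.finBasis k H
  obtain ⟨v, hv⟩ := exists_isCoefficientMatrix (AlgHom.id k H) Function.injective_id
    (fun x => ⟨Coalgebra.comul (R := k) x, by
      rw [AlgHom.toLinearMap_id, TensorProduct.map_id]; rfl⟩) b
  have hφ : IsInvariantFunctional b v (regularTrace k H) := by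
    -- For `R = H` the required matrix identity is $x_2S(x_1)=\epsilon(x)1$ on coefficients.
    refine hv.isInvariantFunctional_trace ?_
    ext i a
    have h := flipMulAntipode_comul hS (v a i)
    rw [hv.comul_coeff, hv.counit_coeff] at h
    simpa [Matrix.mul_apply, Matrix.one_apply, apply_ite, eq_comm] using h
  constructor
  · intro x
    have h : sliceRight (regularTrace k H) ∘ₗ Coalgebra.comul (R := k) =
        Algebra.linearMap k H ∘ₗ regularTrace k H := by
      refine b.ext fun i => ?_
      have h := hv.comul_eq i
      simp only [AlgHom.coe_id, id_eq] at h
      simp only [LinearMap.comp_apply, h, map_sum, sliceRight_tmul, Algebra.linearMap_apply]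
      exact hφ i
    exact LinearMap.congr_fun h x
  · have hrad : leftRadical (regularTrace k H) = ⊥ := by
      -- No commutativity is needed: the radical is already a left ideal of `H`, and it cannot
      -- contain $1$, whose trace is nonzero.
      refine (hv.leftRadical_eq_bot_or hφ).resolve_right fun h => ?_
      rw [AlgHom.coe_id, Set.image_id, Ideal.span_eq] at h
      exact regularTrace_one_ne_zero (k := k) (R := H) (by simpa using h 1)
    let T : H →ₗ[k] Module.Dual k H :=
      LinearMap.mk₂ k (fun y x => regularTrace k H (x * y)) (by simp [mul_add]) (by simp)
        (by simp [add_mul]) (by simp)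
    have hT : Function.Injective T := by
      rw [← LinearMap.ker_eq_bot, eq_bot_iff]
      intro y hy
      have : y ∈ leftRadical (regularTrace k H) := fun x => LinearMap.congr_fun hy x
      rwa [hrad] at this
    obtain ⟨y, hy⟩ := (LinearMap.injective_iff_surjective_of_finrank_eq_finrank
      (Subspace.dual_finrank_eq (K := k) (V := H)).symm).1 hT (Coalgebra.counit (R := k))
    exact ⟨y, fun x => LinearMap.congr_fun hy x⟩

end Involutory

/-! ### Generation of Hopf algebra extensions -/

section Extension

variable {k : Type*} [Field k] {H Q : Type*} [Ring H] [HopfAlgebra k H] [Ring Q]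
  [HopfAlgebra k Q]

/-- Averaging along `π` with respect to an integral on `Q` yields coinvariants. -/
theorem sliceRight_comul_mem_hopfCoinvariants (π : H →ₐc[k] Q) (φ : Q →ₗ[k] k)
    (hφ : ∀ x, sliceRight φ (Coalgebra.comul (R := k) x) = algebraMap k Q (φ x)) (m : H) :
    sliceRight (φ ∘ₗ (π : H →ₗ[k] Q)) (Coalgebra.comul (R := k) m) ∈ hopfCoinvariants π := by
  set f : H →ₗ[k] k := φ ∘ₗ (π : H →ₗ[k] Q) with hf
  have h1 : ∀ (x : H) (w : H ⊗[k] H),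
      TensorProduct.map LinearMap.id (π : H →ₗ[k] Q)
        (sliceRight f ((TensorProduct.assoc k H H H).symm (x ⊗ₜ[k] w))) =
      x ⊗ₜ[k] sliceRight φ (TensorProduct.map (π : H →ₗ[k] Q) (π : H →ₗ[k] Q) w) := by
    intro x w
    induction w with
    | zero => simp
    | add s t hs ht => simp only [TensorProduct.tmul_add, map_add, hs, ht]
    | tmul a b => simp [hf]
  -- Applied to $\Delta(m)$ after coassociativity, this is
  -- $m_1\otimes\pi(m_2)\varphi(\pi(m_3))=m_1\varphi(\pi(m_2))\otimes 1$.
  have h2 : ∀ s : H ⊗[k] H,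
      TensorProduct.map LinearMap.id (π : H →ₗ[k] Q) (sliceRight f
        ((TensorProduct.assoc k H H H).symm
          ((Coalgebra.comul (R := k)).lTensor H s))) = sliceRight f s ⊗ₜ[k] (1 : Q) := by
    intro s
    induction s with
    | zero => simp
    | add s t hs ht => simp only [TensorProduct.add_tmul, map_add, hs, ht]
    | tmul a b =>
      have hπ : TensorProduct.map (π : H →ₗ[k] Q) (π : H →ₗ[k] Q)
          (Coalgebra.comul (R := k) b) = Coalgebra.comul (R := k) (π b) :=
        CoalgHomClass.map_comp_comul_apply π b
      rw [LinearMap.lTensor_tmul, h1, hπ, hφ, sliceRight_tmul, hf,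
        Algebra.algebraMap_eq_smul_one, TensorProduct.tmul_smul, TensorProduct.smul_tmul']
      rfl
  rw [hopfCoinvariants, Set.mem_ofPred_eq, ← h2, Coalgebra.coassoc_symm_apply,
    sliceRight_rTensor]

/-- If the image of `f : U → H`, with `U` involutory, contains the coinvariants of `π : H → Q` and
is mapped by `π` onto `Q`, then `f` is surjective. -/
theorem surjective_of_hopfCoinvariants_subset [CharZero k] [FiniteDimensional k Q]
    {U : Type*} [Ring U] [HopfAlgebra k U]
    (hU : ∀ x : U, HopfAlgebra.antipode k (HopfAlgebra.antipode k x) = x)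
    (hQ : ∀ x : Q, HopfAlgebra.antipode k (HopfAlgebra.antipode k x) = x)
    (f : U →ₐc[k] H) (π : H →ₐc[k] Q) (hπf : Function.Surjective fun t => π (f t))
    (hco : hopfCoinvariants π ⊆ Set.range f) : Function.Surjective f := by
  obtain ⟨hφ, y, hy⟩ := exists_regularTrace_mul_eq_counit (k := k) hQ
  set φ := regularTrace k Q
  obtain ⟨t, ht⟩ := hπf y
  set g : H →ₗ[k] k := φ ∘ₗ (π : H →ₗ[k] Q) with hg
  let B : Subalgebra k H := (f : U →ₐ[k] H).range
  have hfB : ∀ u, f u ∈ B := fun u => ⟨u, rfl⟩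
  have hE : ∀ m, sliceRight g (Coalgebra.comul (R := k) m) ∈ B := fun m => by
    obtain ⟨u, hu⟩ := hco (sliceRight_comul_mem_hopfCoinvariants π φ hφ m)
    rw [← hu]
    exact hfB u
  intro h
  let F : U ⊗[k] U →ₗ[k] H ⊗[k] H :=
    TensorProduct.map (f : U →ₗ[k] H) (f : U →ₗ[k] H)
  have hF : ∀ u, Coalgebra.comul (R := k) (f u) = F (Coalgebra.comul (R := k) u) := fun u =>
    (CoalgHomClass.map_comp_comul_apply f u).symm
  -- With $z=\Delta(h)$ and $a\otimes w=t_1\otimes\Delta(t_2)$ this gives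
  -- $E(hf(t_2))f(S(t_1))=h_1f(t_2S(t_1))\,\varphi(\pi(h_2f(t_3)))$, summed. Since $t_2S(t_1)$
  -- collapses to the counit (`h3`), the choice of `t` leaves $h_1\epsilon(h_2)=h$ (`h4`).
  have h1 : ∀ (z : H ⊗[k] H) (a : U) (w : U ⊗[k] U),
      sliceRight g (z * F w) * f (HopfAlgebra.antipode k a) =
        sliceRight g (z * F ((flipMulAntipode k U).rTensor U
          ((TensorProduct.assoc k U U U).symm (a ⊗ₜ[k] w)))) := by
    intro z a w
    induction w with
    | zero => simp
    | add s t hs ht => simp only [map_add, mul_add, add_mul, TensorProduct.tmul_add, hs, ht]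
    | tmul b c =>
      induction z with
      | zero => simp
      | add s t hs ht => simp only [map_add, add_mul, hs, ht]
      | tmul p q => simp [F, mul_assoc]
  have h2 : ∀ s : U ⊗[k] U, sliceRight g (Coalgebra.comul (R := k) h *
      F ((flipMulAntipode k U).rTensor U ((TensorProduct.assoc k U U U).symm
        ((Coalgebra.comul (R := k)).lTensor U s)))) ∈ B := by
    intro s
    induction s with
    | zero => simp
    | add s t hs ht => simp only [map_add, mul_add]; exact B.add_mem hs ht
    | tmul a b =>
      rw [LinearMap.lTensor_tmul, ← h1, ← hF, ← Bialgebra.comul_mul]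
      exact B.mul_mem (hE _) (hfB _)
  have h3 : (flipMulAntipode k U).rTensor U ((Coalgebra.comul (R := k)).rTensor U
      (Coalgebra.comul (R := k) t)) = 1 ⊗ₜ[k] t := by
    have h : flipMulAntipode k U ∘ₗ Coalgebra.comul (R := k) =
        Algebra.linearMap k U ∘ₗ Coalgebra.counit (R := k) :=
      LinearMap.ext (flipMulAntipode_comul hU)
    rw [← LinearMap.comp_apply, ← LinearMap.rTensor_comp, h, LinearMap.rTensor_comp,
      LinearMap.comp_apply, Coalgebra.rTensor_counit_comul]
    simp
  have h4 : ∀ z : H ⊗[k] H, sliceRight g (z * F (1 ⊗ₜ[k] t)) =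
      sliceRight (Coalgebra.counit (R := k)) z := by
    intro z
    induction z with
    | zero => simp
    | add s t hs ht => simp only [map_add, add_mul, hs, ht]
    | tmul p q =>
      have ht' : π (f t) = y := ht
      simp [F, hg, ht', hy]
  have h5 := h2 (Coalgebra.comul (R := k) t)
  rw [Coalgebra.coassoc_symm_apply, h3, h4, sliceRight, LinearMap.comp_apply,
    Coalgebra.lTensor_counit_comul] at h5
  obtain ⟨u, hu⟩ := h5
  exact ⟨u, hu.trans (by simp)⟩

end Extension

/-! ### Extensions of quantum permutation algebras -/

section Main

variable {k : Type*} [Field k] {H : Type*} [Ring H] [HopfAlgebra k H]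

/-- The coefficient algebra of a block sum contains those of the blocks. -/
theorem adjoin_le_adjoin_reindex_fromBlocks {m n : ℕ} (v : Matrix (Fin m) (Fin m) H)
    (w : Matrix (Fin n) (Fin n) H) :
    Algebra.adjoin k (Set.range fun p : Fin m × Fin m => v p.1 p.2) ⊔
        Algebra.adjoin k (Set.range fun p : Fin n × Fin n => w p.1 p.2) ≤
      Algebra.adjoin k (Set.range fun p : Fin (m + n) × Fin (m + n) =>
        (Matrix.fromBlocks v 0 0 w).submatrix finSumFinEquiv.symm finSumFinEquiv.symm p.1 p.2) := by
  refine sup_le (Algebra.adjoin_mono ?_) (Algebra.adjoin_mono ?_)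
  · rintro _ ⟨p, rfl⟩
    exact ⟨(finSumFinEquiv (Sum.inl p.1), finSumFinEquiv (Sum.inl p.2)), by simp⟩
  · rintro _ ⟨p, rfl⟩
    exact ⟨(finSumFinEquiv (Sum.inr p.1), finSumFinEquiv (Sum.inr p.2)), by simp⟩

/-- Enlarge a magic corepresentation by those of finitely many commutative left coideal
subalgebras. -/
theorem exists_isMagicCorepresentation_sum [IsAlgClosed k] [CharZero k] [FiniteDimensional k H]
    (hH : IsCosemisimple k H) {α : Type*} [DecidableEq α] (L : α → Subalgebra k H) {m : ℕ}
    {w : Matrix (Fin m) (Fin m) H} (hw : IsMagicCorepresentation k w) (Y : Finset α)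
    (hL : ∀ x ∈ Y, IsCommLeftCoidealSubalgebra (L x)) :
    ∃ v : Matrix (Fin (m + ∑ x ∈ Y, Module.finrank k (L x)))
        (Fin (m + ∑ x ∈ Y, Module.finrank k (L x))) H,
      IsMagicCorepresentation k v ∧
      (∀ i j, w i j ∈ Algebra.adjoin k (Set.range fun p : _ × _ => v p.1 p.2)) ∧
      ∀ x ∈ Y, L x ≤ Algebra.adjoin k (Set.range fun p : _ × _ => v p.1 p.2) := by
  suffices h : ∃ n, n = m + ∑ x ∈ Y, Module.finrank k (L x) ∧
      ∃ v : Matrix (Fin n) (Fin n) H, IsMagicCorepresentation k v ∧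
      (∀ i j, w i j ∈ Algebra.adjoin k (Set.range fun p : _ × _ => v p.1 p.2)) ∧
      ∀ x ∈ Y, L x ≤ Algebra.adjoin k (Set.range fun p : _ × _ => v p.1 p.2) by
    obtain ⟨n, rfl, h⟩ := h
    exact h
  obtain ⟨ψ, hψ1, hψ⟩ := hH.exists_integral
  induction Y using Finset.induction_on with
  | empty =>
    exact ⟨m, by simp, w, hw, fun i j => Algebra.subset_adjoin (Set.mem_range_self (i, j)),
      by simp⟩
  | insert x Y hx ih =>
    obtain ⟨n, hn, v, hv, hvw, hvL⟩ := ih fun y hy => hL y (Finset.mem_insert_of_mem hy)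
    have hLx := hL x (Finset.mem_insert_self _ _)
    -- Extending the existing ring structure keeps the algebra structure and the inclusion
    -- compatible.
    let _ : CommRing (L x) :=
      { (inferInstance : Ring (L x)) with
        mul_comm := fun a b => Subtype.ext (hLx.mul_comm a a.2 b b.2) }
    obtain ⟨u, hu, huL⟩ := exists_isMagicCorepresentation_of_coideal (R := L x) (L x).val
      Subtype.val_injective (fun y => hLx.comul_mem y y.2) ψ hψ1 hψ
    have hle := adjoin_le_adjoin_reindex_fromBlocks (k := k) v u
    refine ⟨n + Module.finrank k (L x), ?_, _, (hv.fromBlocks hu).reindex finSumFinEquiv,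
      fun i j => hle (le_sup_left (α := Subalgebra k H) (hvw i j)), fun y hy => ?_⟩
    · rw [Finset.sum_insert hx, hn]; ring
    · rcases Finset.mem_insert.1 hy with rfl | hy
      · exact fun z hz => hle (le_sup_right (α := Subalgebra k H) (huL ⟨z, hz⟩))
      · exact (hvL y hy).trans (le_sup_left.trans hle)

theorem QPerm.antipode_antipode (n : ℕ) (x : QPerm k n) :
    HopfAlgebra.antipode k (HopfAlgebra.antipode k x) = x :=
  (IsMagicCorepresentation.of_bialgHom
    (BialgHom.id k (QPerm k n))).antipode_antipode_of_adjoin_eq_top QPerm.adjoin_u x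

theorem BialgHom.antipode_antipode_of_surjective {n : ℕ} (f : QPerm k n →ₐc[k] H)
    (hf : Function.Surjective f) (x : H) :
    HopfAlgebra.antipode k (HopfAlgebra.antipode k x) = x := by
  refine (IsMagicCorepresentation.of_bialgHom f).antipode_antipode_of_adjoin_eq_top ?_ x
  have h : ((f : QPerm k n →ₐ[k] H)).range = ⊤ := (AlgHom.range_eq_top _).2 hf
  rw [← h, ← Algebra.map_top, ← QPerm.adjoin_u, AlgHom.map_adjoin, ← Set.range_comp]
  rfl

theorem IsMagicCorepresentation.range_toBialgHom {n : ℕ} {v : Matrix (Fin n) (Fin n) H}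
    (hv : IsMagicCorepresentation k v) :
    (hv.toBialgHom : QPerm k n →ₐ[k] H).range =
      Algebra.adjoin k (Set.range fun p : Fin n × Fin n => v p.1 p.2) := by
  rw [← Algebra.map_top, ← QPerm.adjoin_u, AlgHom.map_adjoin, ← Set.range_comp]
  congr 2
  funext p
  exact hv.toBialgHom_u p.1 p.2

end Main

end

theorem theorem3p2 {k : Type*} [Field k] [IsAlgClosed k] [CharZero k]
    {A H Q : Type*} [Ring A] [HopfAlgebra k A] [Ring H] [HopfAlgebra k H]
    [Ring Q] [HopfAlgebra k Q] [DecidableEq Q]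
    [FiniteDimensional k H] (hH : IsCosemisimple k H)
    (ι : A →ₐc[k] H) (π : H →ₐc[k] Q) (hex : IsHopfExact ι π)
    (hA : IsQuantumPermutationAlgebra k A)
    (X : Finset Q) (hX : Algebra.adjoin k (X : Set Q) = ⊤)
    (L : Q → Subalgebra k H)
    (hL : ∀ x ∈ X, IsCommLeftCoidealSubalgebra (L x))
    (hmem : ∀ x ∈ X, x ∈ π '' (L x : Set H)) :
    IsQuantumPermutationAlgebra k H ∧
      qpDegree k H ≤ qpDegree k A + ∑ x ∈ X.erase 1, Module.finrank k (L x) := by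
  -- The degree is attained, the set being nonempty by `hA`.
  obtain ⟨hd, f, hf⟩ : qpDegree k A ∈ {n : ℕ | 1 ≤ n ∧ IsQPermQuotient k A n} := Nat.sInf_mem hA
  obtain ⟨v, hv, hvA, hvL⟩ := exists_isMagicCorepresentation_sum hH L
    (IsMagicCorepresentation.of_bialgHom (ι.comp f)) (X.erase 1)
    fun x hx => hL x (Finset.mem_of_mem_erase hx)
  set N := qpDegree k A + ∑ x ∈ X.erase 1, Module.finrank k (L x)
  have hrange := hv.range_toBialgHom
  have hιA : Set.range ι ⊆ (hv.toBialgHom : QPerm k N →ₐ[k] H).range := by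
    rintro _ ⟨a, rfl⟩
    obtain ⟨t, rfl⟩ := hf a
    have ht : t ∈ Algebra.adjoin k (Set.range fun p : _ × _ => QPerm.u k p.1 p.2) :=
      QPerm.adjoin_u (k := k) ▸ trivial
    rw [hrange]
    induction ht using Algebra.adjoin_induction with
    | mem x hx => obtain ⟨p, rfl⟩ := hx; exact hvA p.1 p.2
    | algebraMap r =>
      have : ι (f (algebraMap k _ r)) = algebraMap k H r :=
        AlgHomClass.commutes (ι.comp f) r
      rw [this]
      exact Subalgebra.algebraMap_mem _ r
    | add x y _ _ hx hy => rw [map_add, map_add]; exact Subalgebra.add_mem _ hx hy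
    | mul x y _ _ hx hy => rw [map_mul, map_mul]; exact Subalgebra.mul_mem _ hx hy
  have hQ : ((π.comp hv.toBialgHom : QPerm k N →ₐc[k] Q) : QPerm k N →ₐ[k] Q).range = ⊤ := by
    rw [eq_top_iff, ← hX, Algebra.adjoin_le_iff]
    intro x hx
    -- The unit lies in every subalgebra, so $x=1$ needs no block; hence `X.erase 1`.
    by_cases h1 : x = 1
    · rw [h1]; exact Subalgebra.one_mem _
    · obtain ⟨l, hl, rfl⟩ := hmem x hx
      have hl' : l ∈ (hv.toBialgHom : QPerm k N →ₐ[k] H).range := by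
        rw [hrange]
        exact hvL _ (Finset.mem_erase.2 ⟨h1, hx⟩) hl
      obtain ⟨t, rfl⟩ := hl'
      exact ⟨t, rfl⟩
  have hπf : Function.Surjective (π.comp hv.toBialgHom) := (AlgHom.range_eq_top _).1 hQ
  have : FiniteDimensional k Q :=
    Module.Finite.of_surjective (π : H →ₗ[k] Q) hex.surjective
  have hsurj : Function.Surjective hv.toBialgHom :=
    -- `Q` is involutory because the composite `hπf` presents it as a quotient of $\mathcal A_s(N)$.
    surjective_of_hopfCoinvariants_subset (QPerm.antipode_antipode _)
      (BialgHom.antipode_antipode_of_surjective _ hπf) hv.toBialgHom π hπf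
      (hex.range_eq ▸ hιA)
  have hN : 1 ≤ N := le_add_right hd
  exact ⟨⟨_, hN, _, hsurj⟩, Nat.sInf_le ⟨hN, _, hsurj⟩⟩
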